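/- Let $x_l<x_r$, and let $\sigma_{s0},\sigma_a\in C^1([x_l,x_r])$ be strictly positive (the one-dimensional subcritical case). For $h:[-1,1]\to\mathbb R$ write $\langle h\rangle=\frac12\int_{-1}^1 h(v)\,dv$ and $\mathcal L h=\langle h\rangle-h$. Let $\Gamma_\pm=\{(x,v): x\in\{x_l,x_r\},\ v\in[-1,1],\ \pm v\,n_x>0\}$ with $n_{x_l}=-1$, $n_{x_r}=1$. Let $\phi$ be arbitrary inflow data on $\Gamma_-$ (independent of $\mathsf{Kn}$), let $y\in\{x_l,x_r\}$, and let $\delta_y$ be the delta function on the two-point boundary, i.e. $\delta_y(y)=1$ and $\delta_y=0$ at the other end point. For $\mathsf{Kn}>0$ let $f_0$ and $g$ be solutions of $$v\,\partial_x f_0=\tfrac1{\mathsf{Kn}}\sigma_{s0}\mathcal L f_0-\mathsf{Kn}\,\sigma_a f_0,\quad f_0|_{\Gamma_-}=\phi,\qquad\qquad -v\,\partial_x g=\tfrac1{\mathsf{Kn}}\sigma_{s0}\mathcal L g-\mathsf{Kn}\,\sigma_a g,\quad g|_{\Gamma_+}=\delta_y$$ in $(x_l,x_r)\times[-1,1]$.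 Here a solution is a bounded function, measurable in $v$ for each $x$, which for each fixed $v\neq0$ is continuous in $x\in[x_l,x_r]$, differentiable in $x\in(x_l,x_r)$, and satisfies the equation there (so $\phi$ is bounded and measurable in $v$). Put $$\gamma_{\mathsf{Kn}}(x)=\frac1{\mathsf{Kn}}\langle g(x,\cdot)\,\mathcal L f_0(x,\cdot)\rangle .$$ Then: 1. For every $\mathsf{Kn}>0$ and all such solutions $f_0,g$, the functions $\langle f_0\rangle\langle g\rangle$ and $\gamma_{\mathsf{Kn}}$ are differentiable at every $x\in(x_l,x_r)$, and $$\frac{d}{dx}\gamma_{\mathsf{Kn}}(x)=\frac{\mathsf{Kn}}{\mathsf{Kn}^2+\sigma_{s0}(x)/\sigma_a(x)}\,\frac{d}{dx}\bigl(\langle f_0\rangle\langle g\rangle\bigr)(x).$$ 2. If $f_0=f_0^{\mathsf{Kn}}$ and $g=g^{\mathsf{Kn}}$ are such solutions for each $\mathsf{Kn}>0$, then $\frac{d}{dx}\gamma_{\mathsf{Kn}}\to0$ as $\mathsf{Kn}\to0^+$, locally uniformly on the open interval $(x_l,x_r)$ (in particular at every interior point). -/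

import Mathlib

open Set Filter Topology MeasureTheory

noncomputable section

/-- The normalized velocity average `⟨h⟩ = (1/2) ∫_{-1}^1 h(v) dv`. -/
def velAvg (h : ℝ → ℝ) : ℝ := (1 / 2) * ∫ v in (-1 : ℝ)..1, h v

/-- The collision operator `ℒ h = ⟨h⟩ - h`. -/
def collision (h : ℝ → ℝ) (v : ℝ) : ℝ := velAvg h - h v

/-- The incoming boundary `Γ₋` of the phase space `(xl, xr) × [-1, 1]`. -/
def inflowBdry (xl xr : ℝ) : Set (ℝ × ℝ) :=
  {p | (p.1 = xl ∧ 0 < p.2 ∧ p.2 ≤ 1) ∨ (p.1 = xr ∧ -1 ≤ p.2 ∧ p.2 < 0)}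

/-- The outgoing boundary `Γ₊` of the phase space `(xl, xr) × [-1, 1]`. -/
def outflowBdry (xl xr : ℝ) : Set (ℝ × ℝ) :=
  {p | (p.1 = xl ∧ -1 ≤ p.2 ∧ p.2 < 0) ∨ (p.1 = xr ∧ 0 < p.2 ∧ p.2 ≤ 1)}

/-- The delta function at `y` on the spatial boundary `{xl, xr}`. The boundary of an interval is a
two-point set with counting measure, so this is the function equal to `1` at `y` and to `0` at the
other end point. -/
def bdryDelta (y : ℝ) : ℝ → ℝ := Set.indicator {y} (fun _ => 1)

/-- A function on the phase space `[xl, xr] × [-1, 1]` that is bounded, measurable in velocity at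
each position, and, along each characteristic (that is, for each fixed `v ≠ 0`), continuous up to
the boundary and differentiable in the interior. Nothing is asked at the null set `v = 0`. -/
structure IsPhaseFunction (xl xr : ℝ) (f : ℝ → ℝ → ℝ) : Prop where
  bounded : ∃ M : ℝ, ∀ x ∈ Icc xl xr, ∀ v ∈ Icc (-1 : ℝ) 1, |f x v| ≤ M
  measurable : ∀ x ∈ Icc xl xr,
    AEStronglyMeasurable (f x) (volume.restrict (Icc (-1 : ℝ) 1))
  continuousOn : ∀ v ∈ Icc (-1 : ℝ) 1, v ≠ 0 → ContinuousOn (fun x => f x v) (Icc xl xr)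
  differentiableAt : ∀ v ∈ Icc (-1 : ℝ) 1, v ≠ 0 → ∀ x ∈ Ioo xl xr,
    DifferentiableAt ℝ (fun z => f z v) x

/-- `f` is a bounded solution of the one-dimensional radiative transfer equation
`v ∂ₓf = (1/Kn) σs ℒf - Kn σa f` in `(xl, xr) × [-1, 1]` with `f = φ` on `Γ₋`. -/
structure IsRTESolution (xl xr : ℝ) (σs σa : ℝ → ℝ) (Kn : ℝ) (φ : ℝ × ℝ → ℝ)
    (f : ℝ → ℝ → ℝ) : Prop where
  phase : IsPhaseFunction xl xr f
  equation : ∀ v ∈ Icc (-1 : ℝ) 1, v ≠ 0 → ∀ x ∈ Ioo xl xr,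
    v * deriv (fun z => f z v) x
      = (1 / Kn) * σs x * collision (f x) v - Kn * σa x * f x v
  inflow : ∀ p ∈ inflowBdry xl xr, f p.1 p.2 = φ p

/-- `g` is a bounded solution of the adjoint equation
`-v ∂ₓg = (1/Kn) σs ℒg - Kn σa g` in `(xl, xr) × [-1, 1]` with `g = ψ(x)` on `Γ₊`. -/
structure IsAdjointRTESolution (xl xr : ℝ) (σs σa : ℝ → ℝ) (Kn : ℝ) (ψ : ℝ → ℝ)
    (g : ℝ → ℝ → ℝ) : Prop where
  phase : IsPhaseFunction xl xr g
  equation : ∀ v ∈ Icc (-1 : ℝ) 1, v ≠ 0 → ∀ x ∈ Ioo xl xr,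
    -(v * deriv (fun z => g z v) x)
      = (1 / Kn) * σs x * collision (g x) v - Kn * σa x * g x v
  outflow : ∀ p ∈ outflowBdry xl xr, g p.1 p.2 = ψ p.1

/-- The kernel `γ_Kn(x) = (1/Kn) ∫ g ℒf₀ dv`, with the normalized velocity measure `dv / 2`. -/
def gammaKn (Kn : ℝ) (f₀ g : ℝ → ℝ → ℝ) (x : ℝ) : ℝ :=
  (1 / Kn) * velAvg (fun v => g x v * collision (f₀ x) v)

end

noncomputable section

/-! Reversing `v` turns `g` into a forward solution, so every estimate is proved for forward
solutions only. Put `σ = σs0 + Kn² σa` and `q = σs0 ⟨f⟩ / σ`; the equation reads `∂ₓf = (σ / Kn) (q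
- f) / v`.

Identity. Expanding, `γ = (⟨f₀⟩⟨g⟩ - ⟨f₀ g⟩) / Kn`. The derivative of `⟨f₀ g⟩` is `σs0 / σ` times
that of `⟨f₀⟩⟨g⟩`, by an algebraic identity valid for each `v ≠ 0`
(`hasDerivAt_velAvg_mul_reversed`). The real issue is differentiating under the average despite the
factor `1 / v`. Interpolating between boundedness and the derivative bound makes `⟨f⟩` Hölder-1/2 in
`x`; a linear barrier along characteristics then gives `|q - f| ≤ C √|v|` in the interior
(`abs_sub_localEquilibrium_le`), so `∂ₓf` has an integrable majorant.

Limit. By the identity and the lower bound on `σs0 / σa`, it suffices that `Kn ⟨f⟩' = σ ⟨(q - f) /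
v⟩` tends to zero in the interior, for `f₀` and for the reversed `g`. The maximum principle
(`abs_le_of_inflow`) bounds solutions independently of `Kn`. Slow velocities are handled by the
`√|v|` estimate. Fast ones need the variance `⟨f²⟩ - ⟨f⟩²` to vanish: it is dissipated by the energy
flux `⟨v f²⟩` at rate `1 / Kn`, and that flux is itself `O(Kn)` in the interior. The variance is
therefore small somewhere in a window of length `η Kn`, and its Hölder continuity on the scale `Kn`
carries this to every interior point. -/

/-! ### Calculus of velocity averages. -/

lemma ae_ne_zero_of_mem_Ioc {p : ℝ → Prop} (h : ∀ v ∈ Icc (-1 : ℝ) 1, v ≠ 0 → p v) :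
    ∀ᵐ v : ℝ, v ∈ Ioc (-1 : ℝ) 1 → p v := by
  have h0 : ∀ᵐ v : ℝ, v ≠ 0 := by
    rw [ae_iff]; simp
  filter_upwards [h0] with v hv hv' using h v (Ioc_subset_Icc_self hv') hv

/-- Measurability in the velocity variable. -/
abbrev VelMeasurable (h : ℝ → ℝ) : Prop :=
  AEStronglyMeasurable h (volume.restrict (Icc (-1 : ℝ) 1))

/-- Integrability in the velocity variable. -/
abbrev VelIntegrable (h : ℝ → ℝ) : Prop := IntervalIntegrable h volume (-1) 1

lemma VelMeasurable.restrict_Ioc {h : ℝ → ℝ} (hm : VelMeasurable h) :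
    AEStronglyMeasurable h (volume.restrict (Ioc (-1 : ℝ) 1)) :=
  hm.mono_measure (Measure.restrict_mono Ioc_subset_Icc_self le_rfl)

lemma VelMeasurable.integrable_of_le {h B : ℝ → ℝ} (hm : VelMeasurable h) (hB : VelIntegrable B)
    (hle : ∀ v ∈ Icc (-1 : ℝ) 1, v ≠ 0 → |h v| ≤ B v) : VelIntegrable h := by
  have h1 : (-1 : ℝ) ≤ 1 := by norm_num
  rw [VelIntegrable, intervalIntegrable_iff_integrableOn_Ioc_of_le h1] at hB ⊢
  refine Integrable.mono' hB hm.restrict_Ioc ?_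
  rw [ae_restrict_iff' measurableSet_Ioc]
  exact ae_ne_zero_of_mem_Ioc hle

lemma velIntegrable_const (c : ℝ) : VelIntegrable fun _ => c := intervalIntegrable_const

lemma VelMeasurable.integrable_of_bound {h : ℝ → ℝ} (hm : VelMeasurable h) {C : ℝ}
    (hle : ∀ v ∈ Icc (-1 : ℝ) 1, v ≠ 0 → |h v| ≤ C) : VelIntegrable h :=
  hm.integrable_of_le (velIntegrable_const C) hle

lemma velAvg_mono {h k : ℝ → ℝ} (hh : VelIntegrable h) (hk : VelIntegrable k)
    (hle : ∀ v ∈ Icc (-1 : ℝ) 1, v ≠ 0 → h v ≤ k v) : velAvg h ≤ velAvg k := by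
  unfold velAvg
  have h1 : (-1 : ℝ) ≤ 1 := by norm_num
  have : ∫ v in (-1 : ℝ)..1, h v ≤ ∫ v in (-1 : ℝ)..1, k v := by
    rw [intervalIntegral.integral_of_le h1, intervalIntegral.integral_of_le h1]
    refine integral_mono_ae hh.1 hk.1 ?_
    exact (ae_restrict_iff' measurableSet_Ioc).2 (ae_ne_zero_of_mem_Ioc hle)
  linarith

lemma velAvg_congr {h k : ℝ → ℝ} (he : ∀ v ∈ Icc (-1 : ℝ) 1, v ≠ 0 → h v = k v) :
    velAvg h = velAvg k := by
  unfold velAvg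
  have h1 : (-1 : ℝ) ≤ 1 := by norm_num
  rw [intervalIntegral.integral_congr_ae]
  rw [uIoc_of_le h1]
  exact ae_ne_zero_of_mem_Ioc he

lemma abs_velAvg_le {h B : ℝ → ℝ} (hB : VelIntegrable B)
    (hle : ∀ v ∈ Icc (-1 : ℝ) 1, v ≠ 0 → |h v| ≤ B v) : |velAvg h| ≤ velAvg B := by
  unfold velAvg
  have h1 : (-1 : ℝ) ≤ 1 := by norm_num
  have := intervalIntegral.norm_integral_le_of_norm_le h1
    (ae_ne_zero_of_mem_Ioc (p := fun v => ‖h v‖ ≤ B v) hle) hB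
  rw [abs_mul, abs_of_pos (by norm_num : (0 : ℝ) < 1 / 2)]
  rw [Real.norm_eq_abs] at this
  linarith

lemma velAvg_const (c : ℝ) : velAvg (fun _ => c) = c := by
  simp [velAvg]; ring

lemma velAvg_id_mul (c : ℝ) : velAvg (fun v => c * v) = 0 := by
  rw [velAvg, intervalIntegral.integral_const_mul, integral_id]; norm_num

lemma velAvg_const_mul (c : ℝ) (h : ℝ → ℝ) : velAvg (fun v => c * h v) = c * velAvg h := by
  simp only [velAvg, intervalIntegral.integral_const_mul]; ring

lemma velAvg_add {h k : ℝ → ℝ} (hh : VelIntegrable h) (hk : VelIntegrable k) :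
    velAvg (fun v => h v + k v) = velAvg h + velAvg k := by
  simp only [velAvg, intervalIntegral.integral_add hh hk]; ring

lemma velAvg_sub {h k : ℝ → ℝ} (hh : VelIntegrable h) (hk : VelIntegrable k) :
    velAvg (fun v => h v - k v) = velAvg h - velAvg k := by
  simp only [velAvg, intervalIntegral.integral_sub hh hk]; ring

lemma velAvg_comp_neg (h : ℝ → ℝ) : velAvg (fun v => h (-v)) = velAvg h := by
  simp [velAvg, intervalIntegral.integral_comp_neg]

lemma abs_velAvg_le_const {h : ℝ → ℝ} {C : ℝ}
    (hle : ∀ v ∈ Icc (-1 : ℝ) 1, v ≠ 0 → |h v| ≤ C) : |velAvg h| ≤ C :=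
  (abs_velAvg_le (velIntegrable_const C) hle).trans_eq (velAvg_const C)

/-! ### The weight `|v|^(-3/4)` and differentiation under the average. -/

/-- The integrable velocity weight `|v|^(-3/4)`. -/
def velWeight (v : ℝ) : ℝ := |v| ^ (-(3 / 4) : ℝ)

lemma velIntegrable_velWeight : VelIntegrable velWeight := by
  have h1 : IntervalIntegrable velWeight volume 0 1 := by
    refine (intervalIntegral.intervalIntegrable_rpow' (a := 0) (b := 1)
      (r := (-(3 / 4) : ℝ)) (by norm_num)).congr ?_
    intro v hv
    rw [uIoc_of_le zero_le_one] at hv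
    simp [velWeight, abs_of_pos hv.1]
  have h2 : IntervalIntegrable velWeight volume (-1) 0 := by
    have := (IntervalIntegrable.iff_comp_neg (f := velWeight) (a := 0) (b := 1)).1 h1
    have h3 : (fun x => velWeight (-x)) = velWeight := by
      funext v; simp [velWeight]
    rw [h3] at this
    simpa using this.symm
  exact h2.trans h1

lemma velWeight_nonneg (v : ℝ) : 0 ≤ velWeight v := by unfold velWeight; positivity

lemma velAvg_velWeight_nonneg : 0 ≤ velAvg velWeight := by
  simpa [velAvg_const] using velAvg_mono (velIntegrable_const 0) velIntegrable_velWeight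
    fun v _ _ => velWeight_nonneg v

lemma one_le_velWeight {v : ℝ} (hv : v ∈ Icc (-1 : ℝ) 1) (h0 : v ≠ 0) : 1 ≤ velWeight v :=
  Real.one_le_rpow_of_pos_of_le_one_of_nonpos (abs_pos.2 h0) (abs_le.2 hv) (by norm_num)

lemma inv_sqrt_le_velWeight {v : ℝ} (hv : v ∈ Icc (-1 : ℝ) 1) (h0 : v ≠ 0) :
    (√|v|)⁻¹ ≤ velWeight v := by
  rw [Real.sqrt_eq_rpow, ← Real.rpow_neg (abs_nonneg v)]
  exact Real.rpow_le_rpow_of_exponent_ge (abs_pos.2 h0) (abs_le.2 hv) (by norm_num)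

lemma sqrt_div_le_velWeight {v : ℝ} (hv : v ∈ Icc (-1 : ℝ) 1) (h0 : v ≠ 0) :
    √|v| / |v| ≤ velWeight v := by
  rw [Real.sqrt_div_self]
  exact inv_sqrt_le_velWeight hv h0

/-- The exponent `3/4` lies strictly between the singularity `1/2` that occurs and the integrability
limit `1`. The gap of `1/4` makes the contribution of velocities below a cutoff `t` small. -/
lemma inv_sqrt_le_mul_velWeight {v t : ℝ} (h0 : v ≠ 0) (ht : |v| ≤ t) :
    (√|v|)⁻¹ ≤ t ^ (1 / 4 : ℝ) * velWeight v := by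
  have hv : 0 < |v| := abs_pos.2 h0
  have : (√|v|)⁻¹ = |v| ^ (1 / 4 : ℝ) * velWeight v := by
    rw [Real.sqrt_eq_rpow, ← Real.rpow_neg hv.le, velWeight, ← Real.rpow_add hv]
    norm_num
  rw [this]
  gcongr
  exact velWeight_nonneg v

/-- Differentiation of a velocity average whose integrand has a derivative bounded by a multiple of
`velWeight`. -/
lemma hasDerivAt_velAvg {F F' : ℝ → ℝ → ℝ} {a b x C : ℝ} (hx : x ∈ Ioo a b)
    (hm : ∀ z ∈ Ioo a b, VelMeasurable (F z)) (hi : VelIntegrable (F x))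
    (hm' : VelMeasurable (F' x))
    (hd : ∀ v ∈ Icc (-1 : ℝ) 1, v ≠ 0 → ∀ z ∈ Ioo a b,
      HasDerivAt (fun z => F z v) (F' z v) z)
    (hb : ∀ v ∈ Icc (-1 : ℝ) 1, v ≠ 0 → ∀ z ∈ Ioo a b, |F' z v| ≤ C * velWeight v) :
    HasDerivAt (fun z => velAvg (F z)) (velAvg (F' x)) x := by
  have h1 : (-1 : ℝ) ≤ 1 := by norm_num
  have hn : Ioo a b ∈ 𝓝 x := Ioo_mem_nhds hx.1 hx.2
  have key := intervalIntegral.hasDerivAt_integral_of_dominated_loc_of_deriv_le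
    (μ := volume) (a := -1) (b := 1) (F := F) (F' := F') (x₀ := x) (s := Ioo a b)
    (bound := fun v => C * velWeight v) hn
    (by
      filter_upwards [hn] with z hz
      rw [uIoc_of_le h1]; exact (hm z hz).restrict_Ioc)
    hi
    (by rw [uIoc_of_le h1]; exact hm'.restrict_Ioc)
    (by rw [uIoc_of_le h1]; exact ae_ne_zero_of_mem_Ioc hb)
    (velIntegrable_velWeight.const_mul C)
    (by rw [uIoc_of_le h1]; exact ae_ne_zero_of_mem_Ioc hd)
  exact key.2.const_mul (1 / 2)

/-! ### Comparison and barriers along characteristics. -/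

/-- A function with `V w' + s w ≥ 0` and `V, s > 0` that is nonnegative at the left end point is
nonnegative. -/
lemma nonneg_of_transport_pos {a b V : ℝ} (hV : 0 < V) {w s : ℝ → ℝ}
    (hc : ContinuousOn w (Icc a b)) (hd : ∀ x ∈ Ioo a b, DifferentiableAt ℝ w x)
    (hs : ∀ x ∈ Ioo a b, 0 < s x) (heq : ∀ x ∈ Ioo a b, 0 ≤ V * deriv w x + s x * w x)
    (h0 : 0 ≤ w a) {x : ℝ} (hx : x ∈ Icc a b) : 0 ≤ w x := by
  by_contra! hneg
  have hsub : Icc a x ⊆ Icc a b := Icc_subset_Icc_right hx.2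
  have hcl : IsClosed (Icc a x ∩ w ⁻¹' Ici 0) :=
    (hc.mono hsub).preimage_isClosed_of_isClosed isClosed_Icc isClosed_Ici
  have hcomp : IsCompact (Icc a x ∩ w ⁻¹' Ici 0) :=
    isCompact_Icc.of_isClosed_subset hcl inter_subset_left
  -- `c` is the last point of `[a, x]` with `w ≥ 0`. Beyond it `w < 0`, so the inequality forces `w'
  -- ≥ 0`, and `w` cannot fall below `w c`.
  obtain ⟨c, ⟨hcx, hc0⟩, hmax⟩ := hcomp.exists_isGreatest ⟨a, left_mem_Icc.2 hx.1, h0⟩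
  have hwneg : ∀ z ∈ Ioo c x, w z < 0 := by
    intro z hz
    by_contra! h
    exact absurd (hmax ⟨⟨hcx.1.trans hz.1.le, hz.2.le⟩, h⟩) (not_le.2 hz.1)
  have hsub' : Ioo c x ⊆ Ioo a b := Ioo_subset_Ioo hcx.1 hx.2
  have hmono : MonotoneOn w (Icc c x) := by
    refine monotoneOn_of_deriv_nonneg (convex_Icc c x)
      (hc.mono (Icc_subset_Icc hcx.1 hx.2)) ?_ ?_
    · rw [interior_Icc]
      exact fun z hz => (hd z (hsub' hz)).differentiableWithinAt
    · rw [interior_Icc]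
      intro z hz
      have h1 := heq z (hsub' hz)
      have h2 := mul_neg_of_pos_of_neg (hs z (hsub' hz)) (hwneg z hz)
      by_contra! h
      have := mul_neg_of_pos_of_neg hV h
      linarith
  have := hmono (left_mem_Icc.2 hcx.2) (right_mem_Icc.2 hcx.2) hcx.2
  have hc0' : 0 ≤ w c := hc0
  linarith

/-- Right-to-left variant of `nonneg_of_transport_pos`. -/
lemma nonneg_of_transport_neg {a b V : ℝ} (hV : V < 0) {w s : ℝ → ℝ}
    (hc : ContinuousOn w (Icc a b)) (hd : ∀ x ∈ Ioo a b, DifferentiableAt ℝ w x)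
    (hs : ∀ x ∈ Ioo a b, 0 < s x) (heq : ∀ x ∈ Ioo a b, 0 ≤ V * deriv w x + s x * w x)
    (h0 : 0 ≤ w b) {x : ℝ} (hx : x ∈ Icc a b) : 0 ≤ w x := by
  have hmem : ∀ z ∈ Ioo (-b) (-a), -z ∈ Ioo a b := fun z hz =>
    ⟨by linarith [hz.2], by linarith [hz.1]⟩
  have := nonneg_of_transport_pos (a := -b) (b := -a) (V := -V) (by linarith)
    (w := fun z => w (-z)) (s := fun z => s (-z))
    (hc.comp continuous_neg.continuousOn
      fun z hz => ⟨by linarith [hz.2], by linarith [hz.1]⟩)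
    (fun z hz => (hd _ (hmem z hz)).comp z differentiable_neg.differentiableAt)
    (fun z hz => hs _ (hmem z hz))
    (fun z hz => by
      rw [deriv_comp_neg]
      have := heq _ (hmem z hz)
      linarith)
    (by simpa using h0) (x := -x) ⟨by linarith [hx.2], by linarith [hx.1]⟩
  simpa using this

/-- Linear barrier for `V u' + s u = r`, `V > 0`. -/
lemma abs_le_of_transport_pos {a x V m R₀ R₁ N A B : ℝ} (hV : 0 < V) (hax : a ≤ x) (hm : 0 < m)
    {u s r : ℝ → ℝ} (hc : ContinuousOn u (Icc a x))
    (hd : ∀ z ∈ Ioo a x, DifferentiableAt ℝ u z) (hs : ∀ z ∈ Ioo a x, m ≤ s z)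
    (heq : ∀ z ∈ Ioo a x, V * deriv u z + s z * u z = r z)
    (hr : ∀ z ∈ Ioo a x, |r z| ≤ R₀ + R₁ * (x - z)) (ha : |u a| ≤ N)
    (hA0 : 0 ≤ A) (hB0 : 0 ≤ B) (hBR : R₁ ≤ m * B) (hBN : N ≤ B * (x - a))
    (hA : R₀ + V * B ≤ m * A) : |u x| ≤ A := by
  -- The affine function `A + B (x - z)` of `z` is a supersolution dominating `±u`; at `z = x` it
  -- equals `A`. The term `x - x` is kept so that the claim is literally the compared function at
  -- `x`.
  have main : ∀ ε : ℝ, |ε| = 1 → 0 ≤ A + B * (x - x) + ε * u x := by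
    intro ε hε
    have hε' : ∀ t : ℝ, -|t| ≤ ε * t := fun t => by
      have := neg_abs_le (ε * t)
      rwa [abs_mul, hε, one_mul] at this
    have hBd : ∀ z, HasDerivAt (fun z => A + B * (x - z)) (-B) z := fun z => by
      simpa using (((hasDerivAt_id z).const_sub x).const_mul B).const_add A
    refine nonneg_of_transport_pos (w := fun z => A + B * (x - z) + ε * u z) (s := s) hV
      ?_ ?_ ?_ ?_ ?_ (right_mem_Icc.2 hax)
    · exact ContinuousOn.add (by fun_prop) (hc.const_smul ε)
    · exact fun z hz => (hBd z).differentiableAt.add ((hd z hz).const_mul ε)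
    · exact fun z hz => hm.trans_le (hs z hz)
    · intro z hz
      have h1 : deriv (fun z => A + B * (x - z) + ε * u z) z = -B + ε * deriv u z :=
        ((hBd z).add ((hd z hz).hasDerivAt.const_mul ε)).deriv
      rw [h1]
      have h2 := hε' (r z)
      rw [← heq z hz] at h2
      have h3 := hr z hz
      rw [← heq z hz] at h3
      have hz' : 0 ≤ x - z := by linarith [hz.2]
      have h4 : m * (A + B * (x - z)) ≤ s z * (A + B * (x - z)) :=
        mul_le_mul_of_nonneg_right (hs z hz) (by positivity)
      have h5 : R₁ * (x - z) ≤ m * B * (x - z) := mul_le_mul_of_nonneg_right hBR hz'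
      nlinarith
    · have := hε' (u a)
      linarith
  have h1 := main 1 (by simp)
  have h2 := main (-1) (by simp)
  rw [abs_le]
  constructor <;> linarith

/-- Right-to-left variant of `abs_le_of_transport_pos`. -/
lemma abs_le_of_transport_neg {b x V m R₀ R₁ N A B : ℝ} (hV : V < 0) (hxb : x ≤ b) (hm : 0 < m)
    {u s r : ℝ → ℝ} (hc : ContinuousOn u (Icc x b))
    (hd : ∀ z ∈ Ioo x b, DifferentiableAt ℝ u z) (hs : ∀ z ∈ Ioo x b, m ≤ s z)
    (heq : ∀ z ∈ Ioo x b, V * deriv u z + s z * u z = r z)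
    (hr : ∀ z ∈ Ioo x b, |r z| ≤ R₀ + R₁ * (z - x)) (hb : |u b| ≤ N)
    (hA0 : 0 ≤ A) (hB0 : 0 ≤ B) (hBR : R₁ ≤ m * B) (hBN : N ≤ B * (b - x))
    (hA : R₀ + -V * B ≤ m * A) : |u x| ≤ A := by
  have hmem : ∀ z ∈ Ioo (-b) (-x), -z ∈ Ioo x b := fun z hz =>
    ⟨by linarith [hz.2], by linarith [hz.1]⟩
  have := abs_le_of_transport_pos (a := -b) (x := -x) (V := -V) (by linarith) (by linarith) hm
    (u := fun z => u (-z)) (s := fun z => s (-z)) (r := fun z => r (-z)) (N := N) (A := A) (B := B)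
    (hc.comp continuous_neg.continuousOn
      fun z hz => ⟨by linarith [hz.2], by linarith [hz.1]⟩)
    (fun z hz => (hd _ (hmem z hz)).comp z differentiable_neg.differentiableAt)
    (fun z hz => hs _ (hmem z hz))
    (fun z hz => by
      rw [deriv_comp_neg]
      have := heq _ (hmem z hz)
      linarith)
    (fun z hz => (hr _ (hmem z hz)).trans_eq (by ring))
    (by simpa using hb) hA0 hB0 hBR (hBN.trans_eq (by ring)) hA
  simpa using this

/-! ### Solutions with uniform constants and Hölder regularity in space. -/

/-- A solution of the scaled transport equation for which one constant `Λ` controls the interval,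
the coefficients, the Knudsen number and, away from `v = 0`, the solution itself. -/
structure TransportSolution (xl xr : ℝ) (σs σa : ℝ → ℝ) (Λ Kn : ℝ) (f : ℝ → ℝ → ℝ) : Prop where
  one_le : 1 ≤ Λ
  length : xr - xl ≤ Λ
  Kn_pos : 0 < Kn
  Kn_le : Kn ≤ Λ
  scat_lower : ∀ x ∈ Icc xl xr, Λ⁻¹ ≤ σs x
  scat_upper : ∀ x ∈ Icc xl xr, σs x ≤ Λ
  scat_lipschitz : ∀ x ∈ Icc xl xr, ∀ z ∈ Icc xl xr, |σs x - σs z| ≤ Λ * |x - z|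
  abs_nonneg : ∀ x ∈ Icc xl xr, 0 ≤ σa x
  abs_upper : ∀ x ∈ Icc xl xr, σa x ≤ Λ
  abs_lipschitz : ∀ x ∈ Icc xl xr, ∀ z ∈ Icc xl xr, |σa x - σa z| ≤ Λ * |x - z|
  phase : IsPhaseFunction xl xr f
  equation : ∀ v ∈ Icc (-1 : ℝ) 1, v ≠ 0 → ∀ x ∈ Ioo xl xr,
    v * deriv (fun z => f z v) x
      = (1 / Kn) * σs x * collision (f x) v - Kn * σa x * f x v
  bound : ∀ x ∈ Icc xl xr, ∀ v ∈ Icc (-1 : ℝ) 1, v ≠ 0 → |f x v| ≤ Λ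

/-- The spatial derivative of a solution, as given by the equation. -/
def transportDeriv (σs σa : ℝ → ℝ) (Kn : ℝ) (f : ℝ → ℝ → ℝ) (x v : ℝ) : ℝ :=
  ((1 / Kn) * σs x * (velAvg (f x) - f x v) - Kn * σa x * f x v) / v

/-- The local equilibrium of the transport equation. -/
def localEquilibrium (σs σa : ℝ → ℝ) (Kn : ℝ) (f : ℝ → ℝ → ℝ) (x : ℝ) : ℝ :=
  σs x * velAvg (f x) / (σs x + Kn ^ 2 * σa x)

namespace TransportSolution

variable {xl xr : ℝ} {σs σa : ℝ → ℝ} {Λ Kn : ℝ} {f : ℝ → ℝ → ℝ}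

lemma pos (h : TransportSolution xl xr σs σa Λ Kn f) : 0 < Λ := zero_lt_one.trans_le h.one_le

lemma hasDerivAt (h : TransportSolution xl xr σs σa Λ Kn f) {x v : ℝ} (hx : x ∈ Ioo xl xr)
    (hv : v ∈ Icc (-1 : ℝ) 1) (h0 : v ≠ 0) :
    HasDerivAt (fun z => f z v) (transportDeriv σs σa Kn f x v) x := by
  have h1 := (h.phase.differentiableAt v hv h0 x hx).hasDerivAt
  have h2 := h.equation v hv h0 x hx
  have : transportDeriv σs σa Kn f x v = deriv (fun z => f z v) x := by
    rw [transportDeriv, div_eq_iff h0, mul_comm (deriv _ x), h2, collision]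
  rwa [this]

lemma measurable_transportDeriv (h : TransportSolution xl xr σs σa Λ Kn f) {x : ℝ}
    (hx : x ∈ Icc xl xr) : VelMeasurable (transportDeriv σs σa Kn f x) := by
  have hm := h.phase.measurable x hx
  unfold transportDeriv
  exact (((aestronglyMeasurable_const.sub hm).const_mul _).sub (hm.const_mul _)).mul
    measurable_inv.aestronglyMeasurable

lemma integrable (h : TransportSolution xl xr σs σa Λ Kn f) {x : ℝ}
    (hx : x ∈ Icc xl xr) : VelIntegrable (f x) :=
  VelMeasurable.integrable_of_bound (h.phase.measurable x hx) (h.bound x hx)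

lemma abs_velAvg_le (h : TransportSolution xl xr σs σa Λ Kn f) {x : ℝ}
    (hx : x ∈ Icc xl xr) : |velAvg (f x)| ≤ Λ :=
  abs_velAvg_le_const (h.bound x hx)

lemma total_lower (h : TransportSolution xl xr σs σa Λ Kn f) {x : ℝ}
    (hx : x ∈ Icc xl xr) : Λ⁻¹ ≤ σs x + Kn ^ 2 * σa x := by
  have := h.scat_lower x hx
  have := mul_nonneg (sq_nonneg Kn) (h.abs_nonneg x hx)
  linarith

lemma scat_pos (h : TransportSolution xl xr σs σa Λ Kn f) {x : ℝ}
    (hx : x ∈ Icc xl xr) : 0 < σs x := (inv_pos.2 h.pos).trans_le (h.scat_lower x hx)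

lemma total_pos (h : TransportSolution xl xr σs σa Λ Kn f) {x : ℝ}
    (hx : x ∈ Icc xl xr) : 0 < σs x + Kn ^ 2 * σa x := (inv_pos.2 h.pos).trans_le (h.total_lower hx)

lemma total_upper (h : TransportSolution xl xr σs σa Λ Kn f) {x : ℝ}
    (hx : x ∈ Icc xl xr) : σs x + Kn ^ 2 * σa x ≤ 2 * Λ ^ 3 := by
  have hΛ := h.pos
  have e1 : Kn ^ 2 * σa x ≤ Λ ^ 2 * Λ :=
    mul_le_mul (pow_le_pow_left₀ h.Kn_pos.le h.Kn_le 2) (h.abs_upper x hx) (h.abs_nonneg x hx)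
      (by positivity)
  have e2 : Λ ^ 1 ≤ Λ ^ 3 := pow_le_pow_right₀ h.one_le (by norm_num)
  have e3 := h.scat_upper x hx
  nlinarith

lemma abs_localEquilibrium_le (h : TransportSolution xl xr σs σa Λ Kn f) {x : ℝ}
    (hx : x ∈ Icc xl xr) : |localEquilibrium σs σa Kn f x| ≤ Λ := by
  have h1 := h.scat_pos hx
  have h2 := mul_nonneg (sq_nonneg Kn) (h.abs_nonneg x hx)
  rw [localEquilibrium, abs_div, abs_mul, abs_of_pos h1, abs_of_pos (h.total_pos hx),
    div_le_iff₀ (h.total_pos hx)]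
  have := h.abs_velAvg_le hx
  have h3 := h.pos
  nlinarith

/-- The derivative in terms of the distance to the local equilibrium. -/
lemma transportDeriv_eq (h : TransportSolution xl xr σs σa Λ Kn f) {x : ℝ}
    (hx : x ∈ Icc xl xr) (v : ℝ) : transportDeriv σs σa Kn f x v
      = (σs x + Kn ^ 2 * σa x) / Kn * ((localEquilibrium σs σa Kn f x - f x v) / v) := by
  have h1 := (h.total_pos hx).ne'
  have h2 := h.Kn_pos.ne'
  rw [transportDeriv, localEquilibrium, ← mul_div_assoc]
  congr 1
  field_simp
  ring

lemma abs_transportDeriv_le (h : TransportSolution xl xr σs σa Λ Kn f) {x v : ℝ}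
    (hx : x ∈ Icc xl xr) (hv : v ∈ Icc (-1 : ℝ) 1) (h0 : v ≠ 0) :
    |transportDeriv σs σa Kn f x v| ≤ 4 * Λ ^ 4 / (Kn * |v|) := by
  rw [h.transportDeriv_eq hx, abs_mul, abs_div, abs_div, abs_of_pos (h.total_pos hx),
    abs_of_pos h.Kn_pos, div_mul_div_comm]
  have hK := h.Kn_pos
  have hΛ := h.pos
  have h1 : |localEquilibrium σs σa Kn f x - f x v| ≤ 2 * Λ := by
    have := h.abs_localEquilibrium_le hx
    have := h.bound x hx v hv h0
    have := abs_sub (localEquilibrium σs σa Kn f x) (f x v)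
    linarith
  have h3 : (σs x + Kn ^ 2 * σa x) * |localEquilibrium σs σa Kn f x - f x v|
      ≤ 2 * Λ ^ 3 * (2 * Λ) := mul_le_mul (h.total_upper hx) h1 (_root_.abs_nonneg _) (by positivity)
  refine (div_le_div_of_nonneg_right h3 (by positivity)).trans_eq ?_
  ring

lemma abs_sub_le_div (h : TransportSolution xl xr σs σa Λ Kn f) {x z v : ℝ}
    (hx : x ∈ Icc xl xr) (hz : z ∈ Icc xl xr) (hv : v ∈ Icc (-1 : ℝ) 1) (h0 : v ≠ 0) :
    |f x v - f z v| ≤ 4 * Λ ^ 4 / (Kn * |v|) * |x - z| := by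
  wlog hxz : z < x generalizing x z
  · rcases eq_or_lt_of_le (not_lt.1 hxz) with rfl | hlt
    · simp
    · rw [abs_sub_comm, abs_sub_comm x z]
      exact this hz hx hlt
  have hsub : Icc z x ⊆ Icc xl xr := Icc_subset_Icc hz.1 hx.2
  have hsub' : Ioo z x ⊆ Ioo xl xr := Ioo_subset_Ioo hz.1 hx.2
  obtain ⟨c, hc, he⟩ := exists_hasDerivAt_eq_slope (fun y => f y v)
    (transportDeriv σs σa Kn f · v) hxz ((h.phase.continuousOn v hv h0).mono hsub)
    (fun y hy => h.hasDerivAt (hsub' hy) hv h0)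
  have hpos : 0 < x - z := sub_pos.2 hxz
  rw [eq_div_iff hpos.ne'] at he
  rw [← he, abs_mul]
  gcongr
  exact h.abs_transportDeriv_le (Ioo_subset_Icc_self (hsub' hc)) hv h0

/-- Geometric mean of the trivial bound `2 Λ` and the Lipschitz bound of order `|x - z| / (Kn |v|)`:
half a power of `|x - z|` is given up to make the singularity in `v` integrable. -/
lemma abs_sub_le_sqrt (h : TransportSolution xl xr σs σa Λ Kn f) {x z v : ℝ}
    (hx : x ∈ Icc xl xr) (hz : z ∈ Icc xl xr) (hv : v ∈ Icc (-1 : ℝ) 1) (h0 : v ≠ 0) :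
    |f x v - f z v| ≤ 3 * Λ ^ 3 * √(|x - z| / Kn) * velWeight v := by
  have hK := h.Kn_pos
  have hΛ := h.pos
  have hv' := abs_pos.2 h0
  have h1 : |f x v - f z v| ≤ 2 * Λ := by
    have := h.bound x hx v hv h0
    have := h.bound z hz v hv h0
    have := abs_sub (f x v) (f z v)
    linarith
  have h2 := h.abs_sub_le_div hx hz hv h0
  have h3 : |f x v - f z v| ≤ 3 * Λ ^ 3 * √(|x - z| / Kn) * (√|v|)⁻¹ := by
    refine abs_le_of_sq_le_sq' ?_ (by positivity) |>.2
    have h4 : |f x v - f z v| * |f x v - f z v|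
        ≤ 2 * Λ * (4 * Λ ^ 4 / (Kn * |v|) * |x - z|) :=
      mul_le_mul h1 h2 (_root_.abs_nonneg _) (by positivity)
    rw [mul_pow, mul_pow, Real.sq_sqrt (by positivity), inv_pow, Real.sq_sqrt hv'.le, sq]
    refine h4.trans ?_
    -- The product of the two bounds carries `8 Λ ^ 5`, which is at most `(3 Λ ^ 3) ^ 2`.
    have h5 : Λ ^ 5 ≤ Λ ^ 6 := pow_le_pow_right₀ h.one_le (by norm_num)
    have h6 : 2 * Λ * (4 * Λ ^ 4 / (Kn * |v|) * |x - z|)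
        = 8 * Λ ^ 5 * (|x - z| / Kn * |v|⁻¹) := by
      field_simp; ring
    have h7 : (3 * Λ ^ 3) ^ 2 * (|x - z| / Kn) * |v|⁻¹
        = 9 * Λ ^ 6 * (|x - z| / Kn * |v|⁻¹) := by ring
    rw [h6, h7]
    gcongr
    norm_num
  exact h3.trans (mul_le_mul_of_nonneg_left (inv_sqrt_le_velWeight hv h0) (by positivity))

lemma abs_velAvg_sub_le (h : TransportSolution xl xr σs σa Λ Kn f) {x z : ℝ}
    (hx : x ∈ Icc xl xr) (hz : z ∈ Icc xl xr) :
    |velAvg (f x) - velAvg (f z)| ≤ 3 * Λ ^ 3 * velAvg velWeight * √(|x - z| / Kn) := by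
  rw [← velAvg_sub (h.integrable hx) (h.integrable hz)]
  refine (_root_.abs_velAvg_le (velIntegrable_velWeight.const_mul (3 * Λ ^ 3 * √(|x - z| / Kn)))
    fun v hv h0 => h.abs_sub_le_sqrt hx hz hv h0).trans_eq ?_
  rw [velAvg_const_mul]; ring

end TransportSolution

/-- The constant in the Hölder bound for the source of the transport equation. -/
def sourceConst (Λ : ℝ) : ℝ := 3 * Λ ^ 4 * velAvg velWeight + 3 * Λ ^ 5

namespace TransportSolution

variable {xl xr : ℝ} {σs σa : ℝ → ℝ} {Λ Kn : ℝ} {f : ℝ → ℝ → ℝ}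

lemma sourceConst_nonneg (h : TransportSolution xl xr σs σa Λ Kn f) : 0 ≤ sourceConst Λ := by
  have := h.pos
  have := velAvg_velWeight_nonneg
  unfold sourceConst; positivity

/-- This is the source in the equation for `f - q` with `q` frozen at `x`. It vanishes at `z = x`
and is Hölder-1/2; the free `p` replaces the square root by an affine function of `|x - z|`, the
form the barrier needs. It is later taken to be `|v|`. -/
lemma abs_source_le (h : TransportSolution xl xr σs σa Λ Kn f) {x z p : ℝ} (hp : 0 < p)
    (hx : x ∈ Icc xl xr) (hz : z ∈ Icc xl xr) :
    |σs z * velAvg (f z) - (σs z + Kn ^ 2 * σa z) * localEquilibrium σs σa Kn f x|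
      ≤ sourceConst Λ * √p + sourceConst Λ / (Kn * √p) * |x - z| := by
  have hK := h.Kn_pos
  have hΛ := h.pos
  set q := localEquilibrium σs σa Kn f x
  set d := |x - z|
  have hd0 : 0 ≤ d := _root_.abs_nonneg _
  have hdΛ : d ≤ Λ := (abs_sub_le_iff.2
    ⟨by linarith [hx.2, hz.1], by linarith [hx.1, hz.2]⟩).trans h.length
  -- The equilibrium balances the source at `x` exactly, so only increments between `x` and `z`
  -- remain.
  have hq : σs x * velAvg (f x) = (σs x + Kn ^ 2 * σa x) * q := by
    rw [mul_comm _ q]; exact (div_mul_cancel₀ _ (h.total_pos hx).ne').symm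
  have hsplit : σs z * velAvg (f z) - (σs z + Kn ^ 2 * σa z) * q
      = -(σs z * (velAvg (f x) - velAvg (f z))) - (σs x - σs z) * velAvg (f x)
        + ((σs x - σs z) * q + Kn ^ 2 * (σa x - σa z) * q) := by
    linear_combination hq
  set t := d / Kn
  have ht0 : 0 ≤ t := by positivity
  have hdt : d ≤ Λ * √t := by
    have e1 : d = Kn * t := by simp only [t]; field_simp
    have e2 : d ^ 2 ≤ (Λ * √t) ^ 2 := by
      rw [mul_pow, Real.sq_sqrt ht0, sq, sq]
      nth_rw 2 [e1]
      calc d * (Kn * t) ≤ Λ * (Λ * t) := by gcongr; exact h.Kn_le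
        _ = Λ * Λ * t := by ring
    exact abs_le_of_sq_le_sq' e2 (by positivity) |>.2
  have b1 : |σs z * (velAvg (f x) - velAvg (f z))|
      ≤ Λ * (3 * Λ ^ 3 * velAvg velWeight * √t) := by
    rw [abs_mul, abs_of_pos (h.scat_pos hz)]
    exact mul_le_mul (h.scat_upper z hz) (h.abs_velAvg_sub_le hx hz) (_root_.abs_nonneg _) hΛ.le
  have b2 : |(σs x - σs z) * velAvg (f x)| ≤ Λ * d * Λ := by
    rw [abs_mul]
    exact mul_le_mul (h.scat_lipschitz x hx z hz) (h.abs_velAvg_le hx) (_root_.abs_nonneg _)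
      (by positivity)
  have b3 : |(σs x - σs z) * q| ≤ Λ * d * Λ := by
    rw [abs_mul]
    exact mul_le_mul (h.scat_lipschitz x hx z hz) (h.abs_localEquilibrium_le hx)
      (_root_.abs_nonneg _) (by positivity)
  have b4 : |Kn ^ 2 * (σa x - σa z) * q| ≤ Λ ^ 2 * (Λ * d) * Λ := by
    rw [abs_mul, abs_mul, abs_of_pos (by positivity : 0 < Kn ^ 2)]
    have := h.abs_lipschitz x hx z hz
    have := h.abs_localEquilibrium_le hx
    have := h.Kn_le
    gcongr
  have b5 : |σs z * velAvg (f z) - (σs z + Kn ^ 2 * σa z) * q| ≤ sourceConst Λ * √t := by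
    rw [hsplit]
    have c1 : Λ * d * Λ ≤ Λ ^ 5 * √t := by
      calc Λ * d * Λ ≤ Λ * (Λ * √t) * Λ := by gcongr
        _ = Λ ^ 3 * √t := by ring
        _ ≤ Λ ^ 5 * √t := by gcongr; exacts [h.one_le, by norm_num]
    have c2 : Λ ^ 2 * (Λ * d) * Λ ≤ Λ ^ 5 * √t := by
      calc Λ ^ 2 * (Λ * d) * Λ ≤ Λ ^ 2 * (Λ * (Λ * √t)) * Λ := by gcongr
        _ = Λ ^ 5 * √t := by ring
    have c3 := abs_add_le (-(σs z * (velAvg (f x) - velAvg (f z))) - (σs x - σs z) * velAvg (f x))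
      ((σs x - σs z) * q + Kn ^ 2 * (σa x - σa z) * q)
    have c4 := abs_sub (-(σs z * (velAvg (f x) - velAvg (f z)))) ((σs x - σs z) * velAvg (f x))
    have c5 := abs_add_le ((σs x - σs z) * q) (Kn ^ 2 * (σa x - σa z) * q)
    rw [abs_neg] at c4
    have c6 : sourceConst Λ * √t = Λ * (3 * Λ ^ 3 * velAvg velWeight * √t) + 3 * (Λ ^ 5 * √t) := by
      unfold sourceConst; ring
    rw [c6]
    linarith
  have hsp : 0 < √p := Real.sqrt_pos.2 hp
  have ham : √t ≤ √p + t / √p := by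
    rw [← sub_nonneg]
    have : √p + t / √p - √t = ((√p - √t) ^ 2 + √p * √t) / √p := by
      rw [eq_div_iff hsp.ne', sub_mul, add_mul, div_mul_cancel₀ _ hsp.ne']
      nlinarith [Real.sq_sqrt ht0]
    rw [this]; positivity
  calc _ ≤ sourceConst Λ * √t := b5
    _ ≤ sourceConst Λ * (√p + t / √p) := by
      gcongr; exact h.sourceConst_nonneg
    _ = _ := by simp only [t]; field_simp

end TransportSolution

/-! ### Slow particles are near the local equilibrium. -/

/-- The constant in the bound for the distance to the local equilibrium at positions whose distance
to the boundary is at least `δ`. -/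
def equilibriumConst (Λ δ : ℝ) : ℝ :=
  Λ * (sourceConst Λ + Λ * sourceConst Λ + 2 * Λ ^ 2 / δ)

namespace TransportSolution

variable {xl xr : ℝ} {σs σa : ℝ → ℝ} {Λ Kn : ℝ} {f : ℝ → ℝ → ℝ}

lemma equilibriumConst_nonneg (h : TransportSolution xl xr σs σa Λ Kn f) {δ : ℝ} (hδ : 0 < δ) :
    0 ≤ equilibriumConst Λ δ := by
  have := h.pos
  have := h.sourceConst_nonneg
  unfold equilibriumConst; positivity

/-- Slow particles in the interior are close to the local equilibrium. -/
lemma abs_sub_localEquilibrium_le (h : TransportSolution xl xr σs σa Λ Kn f) {δ x v : ℝ}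
    (hδ : 0 < δ) (hxl : δ ≤ x - xl) (hxr : δ ≤ xr - x) (hv : v ∈ Icc (-1 : ℝ) 1) (h0 : v ≠ 0) :
    |localEquilibrium σs σa Kn f x - f x v| ≤ equilibriumConst Λ δ * √|v| := by
  have hK := h.Kn_pos
  have hΛ := h.pos
  have hG := h.sourceConst_nonneg
  have hp : 0 < |v| := abs_pos.2 h0
  have hsp : 0 < √|v| := Real.sqrt_pos.2 hp
  have hx : x ∈ Ioo xl xr := ⟨by linarith, by linarith⟩
  have hx' := Ioo_subset_Icc_self hx
  set q := localEquilibrium σs σa Kn f x with hq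
  set u : ℝ → ℝ := fun z => f z v - q with hu
  set s : ℝ → ℝ := fun z => σs z + Kn ^ 2 * σa z with hs
  set r : ℝ → ℝ := fun z => σs z * velAvg (f z) - (σs z + Kn ^ 2 * σa z) * q with hr
  -- The first summand absorbs the slope of the source, the damping being at least `Λ⁻¹`. The second
  -- makes the barrier exceed `2 Λ` at the inflow end, at distance at least `δ`.
  set B := Λ * (sourceConst Λ / (Kn * √|v|)) + 2 * Λ / δ with hB
  have hB0 : 0 ≤ B := by positivity
  have hc : ContinuousOn u (Icc xl xr) := (h.phase.continuousOn v hv h0).sub continuousOn_const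
  have hd : ∀ z ∈ Ioo xl xr, DifferentiableAt ℝ u z := fun z hz =>
    (h.phase.differentiableAt v hv h0 z hz).sub_const q
  have heq : ∀ z ∈ Ioo xl xr, Kn * v * deriv u z + s z * u z = r z := by
    intro z hz
    have e1 : deriv u z = deriv (fun z => f z v) z := deriv_sub_const q
    have e2 := h.equation v hv h0 z hz
    rw [e1, mul_assoc, e2]
    simp only [hs, hu, hr, collision]
    field_simp
    ring
  have hub : ∀ z ∈ Icc xl xr, |u z| ≤ 2 * Λ := by
    intro z hz
    have := h.abs_localEquilibrium_le hx'
    have := h.bound z hz v hv h0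
    have := abs_sub (f z v) q
    simp only [hu]; linarith
  have hBR : sourceConst Λ / (Kn * √|v|) ≤ Λ⁻¹ * B := by
    have : Λ⁻¹ * B = sourceConst Λ / (Kn * √|v|) + 2 / δ := by
      rw [hB]; field_simp
    rw [this]
    have : 0 ≤ 2 / δ := by positivity
    linarith
  have hBN : ∀ d, δ ≤ d → 2 * Λ ≤ B * d := by
    intro d hd
    have e1 : 2 * Λ / δ ≤ B := le_add_of_nonneg_left (by positivity)
    calc 2 * Λ = 2 * Λ / δ * δ := by field_simp
      _ ≤ B * d := by gcongr
  -- With `p = |v|`, the constant part of the source and the transport term `Kn |v| B` are both of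
  -- order `√|v|`.
  have hA : sourceConst Λ * √|v| + Kn * |v| * B ≤ Λ⁻¹ * (equilibriumConst Λ δ * √|v|) := by
    have e1 : Λ⁻¹ * (equilibriumConst Λ δ * √|v|)
        = (sourceConst Λ + Λ * sourceConst Λ + 2 * Λ ^ 2 / δ) * √|v| := by
      unfold equilibriumConst; field_simp
    have e2 : Kn * |v| * B = Λ * sourceConst Λ * √|v| + Kn * (2 * Λ / δ) * |v| := by
      have e : sourceConst Λ / (Kn * √|v|) * (Kn * |v|) = sourceConst Λ * √|v| := by
        rw [div_mul_eq_mul_div, div_eq_iff (by positivity)]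
        linear_combination -(sourceConst Λ * Kn) * Real.mul_self_sqrt hp.le
      rw [hB]
      linear_combination Λ * e
    have e3 : |v| ≤ √|v| := by
      have h1 : √|v| ≤ 1 := Real.sqrt_le_one.2 (abs_le.2 hv)
      nth_rw 1 [← Real.mul_self_sqrt hp.le]
      nlinarith
    have e4 : Kn * (2 * Λ / δ) * |v| ≤ 2 * Λ ^ 2 / δ * √|v| := by
      calc Kn * (2 * Λ / δ) * |v| ≤ Λ * (2 * Λ / δ) * √|v| := by gcongr; exact h.Kn_le
        _ = _ := by ring
    rw [e1, e2]; linarith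
  have hA0 : 0 ≤ equilibriumConst Λ δ * √|v| :=
    mul_nonneg (h.equilibriumConst_nonneg hδ) hsp.le
  rw [abs_sub_comm]
  rcases lt_or_gt_of_ne h0 with hneg | hpos
  · have hsub : Ioo x xr ⊆ Ioo xl xr := Ioo_subset_Ioo_left hx.1.le
    refine abs_le_of_transport_neg (V := Kn * v) (m := Λ⁻¹) (N := 2 * Λ) (B := B) (u := u) (s := s)
      (r := r) (R₀ := sourceConst Λ * √|v|) (R₁ := sourceConst Λ / (Kn * √|v|))
      (mul_neg_of_pos_of_neg hK hneg) hx.2.le (inv_pos.2 hΛ) (hc.mono (Icc_subset_Icc_left hx.1.le))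
      (fun z hz => hd z (hsub hz)) (fun z hz => h.total_lower (Ioo_subset_Icc_self (hsub hz)))
      (fun z hz => heq z (hsub hz)) ?_ (hub xr (right_mem_Icc.2 (hx.1.trans hx.2).le)) hA0 hB0
      hBR (hBN _ hxr) ?_
    · intro z hz
      have := h.abs_source_le hp hx' (Ioo_subset_Icc_self (hsub hz))
      rwa [abs_of_neg (by linarith [hz.1] : x - z < 0), neg_sub] at this
    · rw [abs_of_neg hneg] at hA ⊢
      linarith
  · have hsub : Ioo xl x ⊆ Ioo xl xr := Ioo_subset_Ioo_right hx.2.le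
    refine abs_le_of_transport_pos (V := Kn * v) (m := Λ⁻¹) (N := 2 * Λ) (B := B) (u := u) (s := s)
      (r := r) (R₀ := sourceConst Λ * √|v|) (R₁ := sourceConst Λ / (Kn * √|v|))
      (mul_pos hK hpos) hx.1.le (inv_pos.2 hΛ) (hc.mono (Icc_subset_Icc_right hx.2.le))
      (fun z hz => hd z (hsub hz)) (fun z hz => h.total_lower (Ioo_subset_Icc_self (hsub hz)))
      (fun z hz => heq z (hsub hz)) ?_ (hub xl (left_mem_Icc.2 (hx.1.trans hx.2).le)) hA0 hB0
      hBR (hBN _ hxl) ?_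
    · intro z hz
      have := h.abs_source_le hp hx' (Ioo_subset_Icc_self (hsub hz))
      rwa [abs_of_pos (by linarith [hz.2] : 0 < x - z)] at this
    · rw [abs_of_pos hpos] at hA ⊢
      linarith

end TransportSolution

/-! ### Differentiability and balance laws of velocity moments. -/

lemma VelMeasurable.comp_neg {h : ℝ → ℝ} (hm : VelMeasurable h) :
    VelMeasurable fun v => h (-v) := by
  have hp : MeasurePreserving (fun v : ℝ => -v) (volume.restrict (Icc (-1 : ℝ) 1))
      (volume.restrict (Icc (-1 : ℝ) 1)) := by
    have := (Measure.measurePreserving_neg (volume : Measure ℝ)).restrict_preimage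
      (measurableSet_Icc (a := (-1 : ℝ)) (b := 1))
    have hs : (Neg.neg ⁻¹' Icc (-1 : ℝ) 1) = Icc (-1 : ℝ) 1 := by
      ext v
      simp only [mem_preimage, mem_Icc]
      constructor <;> intro h <;> constructor <;> linarith [h.1, h.2]
    rwa [hs] at this
  exact hm.comp_measurePreserving hp

lemma neg_mem_velIcc {v : ℝ} (hv : v ∈ Icc (-1 : ℝ) 1) : -v ∈ Icc (-1 : ℝ) 1 :=
  ⟨by linarith [hv.2], by linarith [hv.1]⟩

lemma velWeight_neg (v : ℝ) : velWeight (-v) = velWeight v := by simp [velWeight]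

lemma velMeasurable_id : VelMeasurable fun v => v := measurable_id.aestronglyMeasurable

/-- The velocity variance `⟨h²⟩ - ⟨h⟩²`. -/
def velVariance (h : ℝ → ℝ) : ℝ := velAvg (fun v => h v ^ 2) - velAvg h ^ 2

namespace TransportSolution

variable {xl xr : ℝ} {σs σa : ℝ → ℝ} {Λ Kn : ℝ} {f : ℝ → ℝ → ℝ}

/-- The `√|v|` closeness to equilibrium weakens the singularity `1 / |v|` to `1 / √|v|`, uniformly
near `x`. This supplies the majorant for differentiating the density and the pairing. -/
lemma exists_abs_transportDeriv_le (h : TransportSolution xl xr σs σa Λ Kn f) {x : ℝ}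
    (hx : x ∈ Ioo xl xr) : ∃ a b C : ℝ, 0 ≤ C ∧ x ∈ Ioo a b ∧ Ioo a b ⊆ Ioo xl xr ∧
      ∀ v ∈ Icc (-1 : ℝ) 1, v ≠ 0 → ∀ z ∈ Ioo a b,
        |transportDeriv σs σa Kn f z v| ≤ C * velWeight v := by
  have hK := h.Kn_pos
  have hΛ := h.pos
  set δ := min ((x - xl) / 2) ((xr - x) / 2) with hδ
  have hδ0 : 0 < δ := lt_min (by linarith [hx.1]) (by linarith [hx.2])
  have hδl : δ ≤ (x - xl) / 2 := min_le_left _ _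
  have hδr : δ ≤ (xr - x) / 2 := min_le_right _ _
  have hC := h.equilibriumConst_nonneg hδ0
  refine ⟨x - δ, x + δ, 2 * Λ ^ 3 / Kn * equilibriumConst Λ δ, by positivity,
    ⟨by linarith, by linarith⟩, fun z hz => ⟨by linarith [hz.1], by linarith [hz.2]⟩, ?_⟩
  intro v hv h0 z hz
  have hz' : z ∈ Icc xl xr := ⟨by linarith [hz.1], by linarith [hz.2]⟩
  have hv' := abs_pos.2 h0
  rw [h.transportDeriv_eq hz', abs_mul, abs_div, abs_div, abs_of_pos hK,
    abs_of_pos (h.total_pos hz'), mul_assoc]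
  have h1 := h.abs_sub_localEquilibrium_le hδ0 (by linarith [hz.1] : δ ≤ z - xl)
    (by linarith [hz.2]) hv h0
  have h2 : |localEquilibrium σs σa Kn f z - f z v| / |v| ≤ equilibriumConst Λ δ * velWeight v := by
    calc _ ≤ equilibriumConst Λ δ * √|v| / |v| := by gcongr
      _ = equilibriumConst Λ δ * (√|v| / |v|) := by ring
      _ ≤ _ := by gcongr; exact sqrt_div_le_velWeight hv h0
  have h3 := h.total_upper hz'
  gcongr

lemma velIntegrable_transportDeriv (h : TransportSolution xl xr σs σa Λ Kn f) {x : ℝ}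
    (hx : x ∈ Ioo xl xr) : VelIntegrable (transportDeriv σs σa Kn f x) := by
  obtain ⟨a, b, C, -, hab, -, hC⟩ := h.exists_abs_transportDeriv_le hx
  exact (h.measurable_transportDeriv (Ioo_subset_Icc_self hx)).integrable_of_le
    (velIntegrable_velWeight.const_mul C) fun v hv h0 => hC v hv h0 x hab

lemma hasDerivAt_velAvg (h : TransportSolution xl xr σs σa Λ Kn f) {x : ℝ}
    (hx : x ∈ Ioo xl xr) :
    HasDerivAt (fun z => velAvg (f z)) (velAvg (transportDeriv σs σa Kn f x)) x := by
  obtain ⟨a, b, C, -, hab, hsub, hC⟩ := h.exists_abs_transportDeriv_le hx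
  have hsub' : Ioo a b ⊆ Icc xl xr := hsub.trans Ioo_subset_Icc_self
  exact _root_.hasDerivAt_velAvg hab (fun z hz => h.phase.measurable z (hsub' hz))
    (h.integrable (hsub' hab)) (h.measurable_transportDeriv (hsub' hab))
    (fun v hv h0 z hz => h.hasDerivAt (hsub hz) hv h0) hC

/-- Derivative of the pairing of a solution with a velocity-reversed solution. -/
lemma hasDerivAt_velAvg_mul_reversed {g : ℝ → ℝ → ℝ} (h : TransportSolution xl xr σs σa Λ Kn f)
    (hg : TransportSolution xl xr σs σa Λ Kn g) {x : ℝ} (hx : x ∈ Ioo xl xr) :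
    HasDerivAt (fun z => velAvg (fun v => f z v * g z (-v)))
      (σs x / (σs x + Kn ^ 2 * σa x) *
        (velAvg (transportDeriv σs σa Kn f x) * velAvg (g x)
          + velAvg (f x) * velAvg (transportDeriv σs σa Kn g x))) x := by
  have hΛ := h.pos
  obtain ⟨a₁, b₁, C₁, hC₁, hab₁, hsub₁, hb₁⟩ := h.exists_abs_transportDeriv_le hx
  obtain ⟨a₂, b₂, C₂, hC₂, hab₂, hsub₂, hb₂⟩ := hg.exists_abs_transportDeriv_le hx
  have hxx := Ioo_subset_Icc_self hx
  have hl : Ioo (max a₁ a₂) (min b₁ b₂) ⊆ Ioo a₁ b₁ :=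
    Ioo_subset_Ioo (le_max_left _ _) (min_le_left _ _)
  have hr : Ioo (max a₁ a₂) (min b₁ b₂) ⊆ Ioo a₂ b₂ :=
    Ioo_subset_Ioo (le_max_right _ _) (min_le_right _ _)
  have hI : ∀ z ∈ Ioo (max a₁ a₂) (min b₁ b₂), z ∈ Icc xl xr := fun z hz =>
    Ioo_subset_Icc_self (hsub₁ (hl hz))
  have hm : ∀ z ∈ Icc xl xr, VelMeasurable (fun v => f z v * g z (-v)) := fun z hz =>
    (h.phase.measurable z hz).mul (VelMeasurable.comp_neg (hg.phase.measurable z hz))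
  have hng : ∀ z ∈ Icc xl xr, ∀ v ∈ Icc (-1 : ℝ) 1, v ≠ 0 → |g z (-v)| ≤ Λ :=
    fun z hz v hv h0 => hg.bound z hz _ (neg_mem_velIcc hv) (neg_ne_zero.2 h0)
  have key := _root_.hasDerivAt_velAvg (F := fun z v => f z v * g z (-v))
    (F' := fun z v => transportDeriv σs σa Kn f z v * g z (-v)
      + f z v * transportDeriv σs σa Kn g z (-v)) (C := Λ * C₁ + Λ * C₂)
    (⟨max_lt hab₁.1 hab₂.1, lt_min hab₁.2 hab₂.2⟩ : x ∈ Ioo (max a₁ a₂) (min b₁ b₂))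
    (fun z hz => hm z (hI z hz))
    ((hm x hxx).integrable_of_bound (C := Λ * Λ) fun v hv h0 => by
      rw [abs_mul]
      exact mul_le_mul (h.bound x hxx v hv h0) (hng x hxx v hv h0) (_root_.abs_nonneg _) hΛ.le)
    (((h.measurable_transportDeriv hxx).mul
      (VelMeasurable.comp_neg (hg.phase.measurable x hxx))).add
      ((h.phase.measurable x hxx).mul (VelMeasurable.comp_neg (hg.measurable_transportDeriv hxx))))
    (fun v hv h0 z hz => (h.hasDerivAt (hsub₁ (hl hz)) hv h0).mul
      (hg.hasDerivAt (hsub₁ (hl hz)) (neg_mem_velIcc hv) (neg_ne_zero.2 h0)))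
    (fun v hv h0 z hz => by
      have e1 := hb₁ v hv h0 z (hl hz)
      have e2 := hb₂ (-v) (neg_mem_velIcc hv) (neg_ne_zero.2 h0) z (hr hz)
      rw [velWeight_neg] at e2
      have e3 := h.bound z (hI z hz) v hv h0
      have e4 := hng z (hI z hz) v hv h0
      have e5 := velWeight_nonneg v
      refine (abs_add_le _ _).trans ?_
      rw [abs_mul, abs_mul, add_mul, mul_comm Λ C₁]
      refine add_le_add ?_ ?_
      · calc _ ≤ C₁ * velWeight v * Λ := by gcongr
          _ = _ := by ring
      · rw [mul_assoc]; gcongr)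
  convert key using 1
  have hi1 := h.velIntegrable_transportDeriv hx
  have hi2 := ((IntervalIntegrable.iff_comp_neg
    (f := transportDeriv σs σa Kn g x)).1 (hg.velIntegrable_transportDeriv hx)).symm
  rw [neg_neg] at hi2
  rw [← velAvg_comp_neg (transportDeriv σs σa Kn g x), mul_comm _ (velAvg (g x)),
    ← velAvg_const_mul, ← velAvg_const_mul,
    ← velAvg_add (hi1.const_mul _) (hi2.const_mul _), ← velAvg_const_mul]
  -- Because the two velocities are opposite, the terms in `f x v * g x (-v)` cancel on the left and
  -- those in the product of densities cancel on the right. Both sides are then the same multiple of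
  -- `(⟨f⟩ g(-v) - ⟨g⟩ f(v)) / v`.
  refine velAvg_congr fun v hv h0 => ?_
  have hs := (h.total_pos hxx).ne'
  have hK := h.Kn_pos.ne'
  simp only [transportDeriv]
  field_simp
  ring

lemma mul_transportDeriv {x v : ℝ} (h0 : v ≠ 0) : v * transportDeriv σs σa Kn f x v
    = (1 / Kn) * σs x * (velAvg (f x) - f x v) - Kn * σa x * f x v :=
  mul_div_cancel₀ _ h0

lemma abs_mul_transportDeriv_le (h : TransportSolution xl xr σs σa Λ Kn f) {x v : ℝ}
    (hx : x ∈ Icc xl xr) (hv : v ∈ Icc (-1 : ℝ) 1) (h0 : v ≠ 0) :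
    |v * transportDeriv σs σa Kn f x v| ≤ 4 * Λ ^ 4 / Kn := by
  have hv' := abs_pos.2 h0
  have hK := h.Kn_pos
  rw [abs_mul]
  calc _ ≤ |v| * (4 * Λ ^ 4 / (Kn * |v|)) := by gcongr; exact h.abs_transportDeriv_le hx hv h0
    _ = _ := by field_simp

lemma integrable_sq (h : TransportSolution xl xr σs σa Λ Kn f) {x : ℝ} (hx : x ∈ Icc xl xr) :
    VelIntegrable fun v => f x v ^ 2 :=
  VelMeasurable.integrable_of_bound ((h.phase.measurable x hx).pow 2) (C := Λ ^ 2)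
    fun v hv h0 => by rw [abs_pow]; have := h.bound x hx v hv h0; gcongr

lemma integrable_id_mul (h : TransportSolution xl xr σs σa Λ Kn f) {x : ℝ}
    (hx : x ∈ Icc xl xr) : VelIntegrable fun v => v * f x v :=
  VelMeasurable.integrable_of_bound (velMeasurable_id.mul (h.phase.measurable x hx)) (C := 1 * Λ)
    fun v hv h0 => by
      rw [abs_mul]
      exact mul_le_mul (abs_le.2 hv) (h.bound x hx v hv h0) (_root_.abs_nonneg _) zero_le_one

/-- Multiplication by `v` removes the singularity, so no interior estimate is needed. Scattering
conserves mass, leaving only absorption. -/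
lemma hasDerivAt_flux (h : TransportSolution xl xr σs σa Λ Kn f) {x : ℝ} (hx : x ∈ Ioo xl xr) :
    HasDerivAt (fun z => velAvg (fun v => v * f z v)) (-(Kn * σa x * velAvg (f x))) x := by
  have hK := h.Kn_pos
  have hΛ := h.pos
  have hxx := Ioo_subset_Icc_self hx
  have key := _root_.hasDerivAt_velAvg (F := fun z v => v * f z v)
    (F' := fun z v => v * transportDeriv σs σa Kn f z v) (C := 4 * Λ ^ 4 / Kn) hx
    (fun z hz => velMeasurable_id.mul (h.phase.measurable z (Ioo_subset_Icc_self hz)))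
    (h.integrable_id_mul hxx) (velMeasurable_id.mul (h.measurable_transportDeriv hxx))
    (fun v hv h0 z hz => (h.hasDerivAt hz hv h0).const_mul v)
    (fun v hv h0 z hz => (h.abs_mul_transportDeriv_le (Ioo_subset_Icc_self hz) hv h0).trans
      (le_mul_of_one_le_right (by positivity) (one_le_velWeight hv h0)))
  convert key using 1
  have e : velAvg (fun v => v * transportDeriv σs σa Kn f x v)
      = velAvg (fun v => (1 / Kn) * σs x * velAvg (f x)
        - ((1 / Kn) * σs x + Kn * σa x) * f x v) :=
    velAvg_congr fun v hv h0 => by rw [mul_transportDeriv h0]; ring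
  rw [e, velAvg_sub (velIntegrable_const _) ((h.integrable hxx).const_mul _), velAvg_const,
    velAvg_const_mul]
  ring

/-- The density drops out because `⟨v⟩ = 0`. Boundedness of this moment will force the flux to be
`O(Kn)`. -/
lemma hasDerivAt_pressure (h : TransportSolution xl xr σs σa Λ Kn f) {x : ℝ}
    (hx : x ∈ Ioo xl xr) :
    HasDerivAt (fun z => velAvg (fun v => v ^ 2 * f z v))
      (-((σs x + Kn ^ 2 * σa x) / Kn * velAvg (fun v => v * f x v))) x := by
  have hK := h.Kn_pos
  have hΛ := h.pos
  have hxx := Ioo_subset_Icc_self hx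
  have hm : ∀ z ∈ Icc xl xr, VelMeasurable fun v => v ^ 2 * f z v := fun z hz =>
    (velMeasurable_id.pow 2).mul (h.phase.measurable z hz)
  have key := _root_.hasDerivAt_velAvg (F := fun z v => v ^ 2 * f z v)
    (F' := fun z v => v ^ 2 * transportDeriv σs σa Kn f z v) (C := 4 * Λ ^ 4 / Kn) hx
    (fun z hz => hm z (Ioo_subset_Icc_self hz))
    ((hm x hxx).integrable_of_bound (C := 1 * Λ) fun v hv h0 => by
      rw [abs_mul, abs_pow]
      exact mul_le_mul (pow_le_one₀ (_root_.abs_nonneg _) (abs_le.2 hv)) (h.bound x hxx v hv h0)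
        (_root_.abs_nonneg _) zero_le_one)
    ((velMeasurable_id.pow 2).mul (h.measurable_transportDeriv hxx))
    (fun v hv h0 z hz => (h.hasDerivAt hz hv h0).const_mul (v ^ 2))
    (fun v hv h0 z hz => by
      have e1 := h.abs_mul_transportDeriv_le (Ioo_subset_Icc_self hz) hv h0
      have e2 : |v ^ 2 * transportDeriv σs σa Kn f z v|
          ≤ |v * transportDeriv σs σa Kn f z v| := by
        rw [sq, mul_assoc, abs_mul v]
        exact mul_le_of_le_one_left (_root_.abs_nonneg _) (abs_le.2 hv)
      exact (e2.trans e1).trans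
        (le_mul_of_one_le_right (by positivity) (one_le_velWeight hv h0)))
  convert key using 1
  have e : velAvg (fun v => v ^ 2 * transportDeriv σs σa Kn f x v)
      = velAvg (fun v => (1 / Kn) * σs x * velAvg (f x) * v
        - ((1 / Kn) * σs x + Kn * σa x) * (v * f x v)) :=
    velAvg_congr fun v hv h0 => by rw [sq, mul_assoc, mul_transportDeriv h0]; ring
  rw [e, velAvg_sub (VelMeasurable.integrable_of_bound (velMeasurable_id.const_mul _)
      (C := |(1 / Kn) * σs x * velAvg (f x)|) fun v hv h0 => ?_)
    ((h.integrable_id_mul hxx).const_mul _), velAvg_id_mul, velAvg_const_mul]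
  · field_simp; ring
  · rw [abs_mul]
    exact mul_le_of_le_one_right (_root_.abs_nonneg _) (abs_le.2 hv)

/-- Testing the equation with `2 f` turns scattering into minus the variance: this is the
dissipation that drives the variance to zero. -/
lemma hasDerivAt_energyFlux (h : TransportSolution xl xr σs σa Λ Kn f) {x : ℝ}
    (hx : x ∈ Ioo xl xr) :
    HasDerivAt (fun z => velAvg (fun v => v * f z v ^ 2))
      (-(2 * σs x / Kn * velVariance (f x) + 2 * Kn * σa x * velAvg (fun v => f x v ^ 2))) x := by
  have hK := h.Kn_pos
  have hΛ := h.pos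
  have hxx := Ioo_subset_Icc_self hx
  have hm : ∀ z ∈ Icc xl xr, VelMeasurable fun v => v * f z v ^ 2 := fun z hz =>
    velMeasurable_id.mul ((h.phase.measurable z hz).pow 2)
  have key := _root_.hasDerivAt_velAvg (F := fun z v => v * f z v ^ 2)
    (F' := fun z v => 2 * f z v * (v * transportDeriv σs σa Kn f z v))
    (C := 2 * Λ * (4 * Λ ^ 4 / Kn)) hx
    (fun z hz => hm z (Ioo_subset_Icc_self hz))
    ((hm x hxx).integrable_of_bound (C := 1 * Λ ^ 2) fun v hv h0 => by
      rw [abs_mul, abs_pow]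
      exact mul_le_mul (abs_le.2 hv) (pow_le_pow_left₀ (_root_.abs_nonneg _)
        (h.bound x hxx v hv h0) 2) (by positivity) zero_le_one)
    (((h.phase.measurable x hxx).const_mul 2).mul
      (velMeasurable_id.mul (h.measurable_transportDeriv hxx)))
    (fun v hv h0 z hz => by
      refine (((h.hasDerivAt hz hv h0).pow 2).const_mul v).congr_deriv ?_
      norm_num
      ring)
    (fun v hv h0 z hz => by
      refine le_trans ?_ (le_mul_of_one_le_right (by positivity) (one_le_velWeight hv h0))
      rw [abs_mul, abs_mul, abs_two]
      have e1 := h.abs_mul_transportDeriv_le (Ioo_subset_Icc_self hz) hv h0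
      have e2 := h.bound z (Ioo_subset_Icc_self hz) v hv h0
      gcongr)
  convert key using 1
  have e : velAvg (fun v => 2 * f x v * (v * transportDeriv σs σa Kn f x v))
      = velAvg (fun v => 2 * ((1 / Kn) * σs x) * velAvg (f x) * f x v
        - 2 * ((1 / Kn) * σs x + Kn * σa x) * f x v ^ 2) :=
    velAvg_congr fun v hv h0 => by rw [mul_transportDeriv h0]; ring
  rw [e, velAvg_sub ((h.integrable hxx).const_mul _) ((h.integrable_sq hxx).const_mul _),
    velAvg_const_mul, velAvg_const_mul, velVariance]
  ring

end TransportSolution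

/-! ### Decay of the velocity variance in the interior. -/

/-- The constant in the bound for the flux. -/
def fluxConst (Λ δ : ℝ) : ℝ := 2 * Λ ^ 2 / δ + Λ ^ 4

/-- The constant in the bound for the energy flux. -/
def energyFluxConst (Λ δ : ℝ) : ℝ := 2 * Λ * fluxConst Λ (δ / 2) + 2 * Λ ^ 3 / δ

lemma fluxConst_nonneg {Λ δ : ℝ} (hδ : 0 ≤ δ) : 0 ≤ fluxConst Λ δ := by
  unfold fluxConst; positivity

lemma energyFluxConst_nonneg {Λ δ : ℝ} (hΛ : 0 ≤ Λ) (hδ : 0 ≤ δ) : 0 ≤ energyFluxConst Λ δ := by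
  have := fluxConst_nonneg (Λ := Λ) (div_nonneg hδ zero_le_two)
  unfold energyFluxConst; positivity

namespace TransportSolution

variable {xl xr : ℝ} {σs σa : ℝ → ℝ} {Λ Kn : ℝ} {f : ℝ → ℝ → ℝ}

lemma velAvg_sq_sub (h : TransportSolution xl xr σs σa Λ Kn f) {x : ℝ} (hx : x ∈ Icc xl xr)
    (c : ℝ) : velAvg (fun v => (f x v - c) ^ 2) = velVariance (f x) + (velAvg (f x) - c) ^ 2 := by
  have e : velAvg (fun v => (f x v - c) ^ 2)
      = velAvg (fun v => (f x v ^ 2 - 2 * c * f x v) + c ^ 2) :=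
    velAvg_congr fun v _ _ => by ring
  rw [e, velAvg_add ((h.integrable_sq hx).sub ((h.integrable hx).const_mul _))
    (velIntegrable_const _), velAvg_sub (h.integrable_sq hx) ((h.integrable hx).const_mul _),
    velAvg_const, velAvg_const_mul, velVariance]
  ring

lemma velVariance_eq (h : TransportSolution xl xr σs σa Λ Kn f) {x : ℝ} (hx : x ∈ Icc xl xr) :
    velVariance (f x) = velAvg (fun v => (f x v - velAvg (f x)) ^ 2) := by
  rw [h.velAvg_sq_sub hx]; ring

lemma integrable_sq_sub (h : TransportSolution xl xr σs σa Λ Kn f) {x : ℝ} (hx : x ∈ Icc xl xr)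
    (c : ℝ) : VelIntegrable fun v => (f x v - c) ^ 2 := by
  refine VelMeasurable.integrable_of_bound (C := (Λ + |c|) ^ 2)
    (((h.phase.measurable x hx).sub aestronglyMeasurable_const).pow 2) fun v hv h0 => ?_
  rw [abs_pow]
  have e1 := abs_sub (f x v) c
  have e2 := h.bound x hx v hv h0
  gcongr
  linarith

lemma velVariance_nonneg (h : TransportSolution xl xr σs σa Λ Kn f) {x : ℝ}
    (hx : x ∈ Icc xl xr) : 0 ≤ velVariance (f x) := by
  rw [h.velVariance_eq hx, ← velAvg_const 0]
  exact velAvg_mono (velIntegrable_const _) (h.integrable_sq_sub hx _) fun v _ _ => sq_nonneg _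

lemma velAvg_sq_nonneg (h : TransportSolution xl xr σs σa Λ Kn f) {x : ℝ}
    (hx : x ∈ Icc xl xr) : 0 ≤ velAvg (fun v => f x v ^ 2) := by
  rw [← velAvg_const 0]
  exact velAvg_mono (velIntegrable_const _) (h.integrable_sq hx) fun v _ _ => sq_nonneg _

/-- The velocity variance is Hölder continuous on the scale of the Knudsen number. -/
lemma abs_velVariance_sub_le (h : TransportSolution xl xr σs σa Λ Kn f) {x z : ℝ}
    (hx : x ∈ Icc xl xr) (hz : z ∈ Icc xl xr) :
    |velVariance (f x) - velVariance (f z)|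
      ≤ 12 * Λ ^ 4 * velAvg velWeight * √(|x - z| / Kn) := by
  have hΛ := h.pos
  have hW := velAvg_velWeight_nonneg
  set t := √(|x - z| / Kn)
  have ht : 0 ≤ t := Real.sqrt_nonneg _
  have key : ∀ a b : ℝ, |a| ≤ Λ → |b| ≤ Λ → |a ^ 2 - b ^ 2| ≤ 2 * Λ * |a - b| := by
    intro a b ha hb
    rw [sq_sub_sq, abs_mul]
    have := abs_add_le a b
    gcongr
    linarith
  have h1 : |velAvg (fun v => f x v ^ 2) - velAvg (fun v => f z v ^ 2)|
      ≤ 2 * Λ * (3 * Λ ^ 3 * t) * velAvg velWeight := by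
    rw [← velAvg_sub (h.integrable_sq hx) (h.integrable_sq hz), ← velAvg_const_mul]
    refine _root_.abs_velAvg_le (velIntegrable_velWeight.const_mul _) fun v hv h0 => ?_
    refine (key _ _ (h.bound x hx v hv h0) (h.bound z hz v hv h0)).trans ?_
    rw [mul_assoc (2 * Λ)]
    exact mul_le_mul_of_nonneg_left (h.abs_sub_le_sqrt hx hz hv h0) (by positivity)
  have h2 : |velAvg (f x) ^ 2 - velAvg (f z) ^ 2| ≤ 2 * Λ * (3 * Λ ^ 3 * velAvg velWeight * t) :=
    (key _ _ (h.abs_velAvg_le hx) (h.abs_velAvg_le hz)).trans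
      (mul_le_mul_of_nonneg_left (h.abs_velAvg_sub_le hx hz) (by positivity))
  have h3 : velVariance (f x) - velVariance (f z)
      = (velAvg (fun v => f x v ^ 2) - velAvg (fun v => f z v ^ 2))
        - (velAvg (f x) ^ 2 - velAvg (f z) ^ 2) := by unfold velVariance; ring
  rw [h3]
  refine (abs_sub _ _).trans ((add_le_add h1 h2).trans_eq ?_)
  ring

/-- In the interior the flux is of the order of the Knudsen number. -/
lemma abs_flux_le (h : TransportSolution xl xr σs σa Λ Kn f) {δ x : ℝ} (hδ : 0 < δ)
    (hxl : δ ≤ x - xl) (hxr : δ ≤ xr - x) :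
    |velAvg (fun v => v * f x v)| ≤ fluxConst Λ δ * Kn := by
  have hK := h.Kn_pos
  have hΛ := h.pos
  have hsub : Icc (x - δ / 2) (x + δ / 2) ⊆ Ioo xl xr := fun z hz =>
    ⟨by linarith [hz.1], by linarith [hz.2]⟩
  -- The pressure is bounded, so the mean value theorem on a window of length `δ` yields a point
  -- where the flux is `O(Kn)`. Absorption changes the flux by only `O(Kn)` between that point and
  -- `x`.
  obtain ⟨ξ, hξ, he⟩ := exists_hasDerivAt_eq_slope (fun z => velAvg (fun v => v ^ 2 * f z v))
    (fun z => -((σs z + Kn ^ 2 * σa z) / Kn * velAvg (fun v => v * f z v)))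
    (by linarith : x - δ / 2 < x + δ / 2)
    (fun z hz => (h.hasDerivAt_pressure (hsub hz)).continuousAt.continuousWithinAt)
    (fun z hz => h.hasDerivAt_pressure (hsub (Ioo_subset_Icc_self hz)))
  have hξ' := hsub (Ioo_subset_Icc_self hξ)
  have hP : ∀ z ∈ Icc xl xr, |velAvg (fun v => v ^ 2 * f z v)| ≤ Λ := fun z hz =>
    abs_velAvg_le_const fun v hv h0 => by
      rw [abs_mul, abs_pow]
      exact (mul_le_mul (pow_le_one₀ (_root_.abs_nonneg _) (abs_le.2 hv)) (h.bound z hz v hv h0)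
        (_root_.abs_nonneg _) zero_le_one).trans_eq (one_mul _)
  have h1 : |velAvg (fun v => v * f ξ v)| ≤ 2 * Λ ^ 2 / δ * Kn := by
    have e0 := h.total_lower (Ioo_subset_Icc_self hξ')
    have e1 : x + δ / 2 - (x - δ / 2) = δ := by ring
    rw [e1, eq_div_iff hδ.ne'] at he
    have e2 : |(σs ξ + Kn ^ 2 * σa ξ) / Kn * velAvg (fun v => v * f ξ v)| * δ ≤ 2 * Λ := by
      have a0 : ∀ t : ℝ, |t| * δ = |-t * δ| := fun t => by rw [abs_mul, abs_neg, abs_of_pos hδ]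
      rw [a0, he]
      have a1 := hP (x + δ / 2) (Ioo_subset_Icc_self (hsub (right_mem_Icc.2 (by linarith))))
      have a2 := hP (x - δ / 2) (Ioo_subset_Icc_self (hsub (left_mem_Icc.2 (by linarith))))
      exact (abs_sub _ _).trans (by linarith)
    rw [abs_mul, abs_div, abs_of_pos hK, abs_of_pos (h.total_pos (Ioo_subset_Icc_self hξ'))] at e2
    have e3 : Λ⁻¹ / Kn * |velAvg (fun v => v * f ξ v)| * δ ≤ 2 * Λ := le_trans (by gcongr) e2
    have e4 : Λ⁻¹ / Kn * |velAvg (fun v => v * f ξ v)| * δ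
      = |velAvg (fun v => v * f ξ v)| * (δ / (Λ * Kn)) := by field_simp
    rw [e4, ← le_div_iff₀ (by positivity)] at e3
    refine e3.trans_eq ?_
    field_simp
  have h2 : |velAvg (fun v => v * f x v) - velAvg (fun v => v * f ξ v)| ≤ Λ ^ 4 * Kn := by
    have b : ∀ z ∈ Ioo xl xr, ‖-(Kn * σa z * velAvg (f z))‖ ≤ Λ ^ 2 * Kn := by
      intro z hz
      have hz' := Ioo_subset_Icc_self hz
      rw [norm_neg, Real.norm_eq_abs, abs_mul, abs_mul, abs_of_pos hK,
        abs_of_nonneg (h.abs_nonneg z hz')]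
      calc _ ≤ Kn * Λ * Λ := by
            gcongr
            exacts [h.abs_upper z hz', h.abs_velAvg_le hz']
        _ = _ := by ring
    have := (convex_Ioo xl xr).norm_image_sub_le_of_norm_hasDerivWithin_le
      (fun z hz => (h.hasDerivAt_flux hz).hasDerivWithinAt) b hξ'
      (⟨by linarith, by linarith⟩ : x ∈ Ioo xl xr)
    rw [Real.norm_eq_abs, Real.norm_eq_abs] at this
    refine this.trans ?_
    have d : |x - ξ| ≤ Λ := by
      have := h.length
      rw [abs_le]; constructor <;> linarith [hξ'.1, hξ'.2]
    calc Λ ^ 2 * Kn * |x - ξ| ≤ Λ ^ 2 * Kn * Λ := by gcongr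
      _ = Λ ^ 3 * Kn := by ring
      _ ≤ Λ ^ 4 * Kn := by gcongr; exacts [h.one_le, by norm_num]
  have h3 := abs_add_le (velAvg (fun v => v * f x v) - velAvg (fun v => v * f ξ v))
    (velAvg (fun v => v * f ξ v))
  rw [sub_add_cancel] at h3
  have h4 : fluxConst Λ δ * Kn = Λ ^ 4 * Kn + 2 * Λ ^ 2 / δ * Kn := by unfold fluxConst; ring
  rw [h4]
  linarith

lemma abs_energyFlux_le (h : TransportSolution xl xr σs σa Λ Kn f) {x : ℝ}
    (hx : x ∈ Icc xl xr) : |velAvg (fun v => v * f x v ^ 2)| ≤ Λ ^ 2 :=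
  abs_velAvg_le_const fun v hv h0 => by
    rw [abs_mul, abs_pow]
    exact (mul_le_mul (abs_le.2 hv) (pow_le_pow_left₀ (_root_.abs_nonneg _)
      (h.bound x hx v hv h0) 2) (by positivity) zero_le_one).trans_eq (one_mul _)

/-- The energy flux is controlled by the flux and the velocity variance. -/
lemma abs_energyFlux_le_flux (h : TransportSolution xl xr σs σa Λ Kn f) {x : ℝ}
    (hx : x ∈ Icc xl xr) : |velAvg (fun v => v * f x v ^ 2)|
      ≤ 2 * Λ * |velAvg (fun v => v * f x v)| + velVariance (f x) := by
  have hi : VelIntegrable fun v => v * f x v ^ 2 :=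
    VelMeasurable.integrable_of_bound (C := 1 * Λ ^ 2)
      (velMeasurable_id.mul ((h.phase.measurable x hx).pow 2)) fun v hv h0 => by
        rw [abs_mul, abs_pow]
        exact mul_le_mul (abs_le.2 hv) (pow_le_pow_left₀ (_root_.abs_nonneg _)
          (h.bound x hx v hv h0) 2) (by positivity) zero_le_one
  have hid : VelIntegrable fun v => velAvg (f x) ^ 2 * v :=
    (continuous_const.mul continuous_id).intervalIntegrable _ _
  -- Centring at the mean: the squared-mean term vanishes since `⟨v⟩ = 0`, and the centred term is
  -- at most the variance since `|v| ≤ 1`.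
  have e : velAvg (fun v => v * (f x v - velAvg (f x)) ^ 2)
      = velAvg (fun v => v * f x v ^ 2) - 2 * velAvg (f x) * velAvg (fun v => v * f x v) := by
    have : velAvg (fun v => v * (f x v - velAvg (f x)) ^ 2)
      = velAvg (fun v => (v * f x v ^ 2 - 2 * velAvg (f x) * (v * f x v))
        + velAvg (f x) ^ 2 * v) := velAvg_congr fun v _ _ => by ring
    rw [this, velAvg_add (hi.sub ((h.integrable_id_mul hx).const_mul _)) hid,
      velAvg_sub hi ((h.integrable_id_mul hx).const_mul _), velAvg_const_mul, velAvg_id_mul,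
      add_zero]
  have h1 : |velAvg (fun v => v * (f x v - velAvg (f x)) ^ 2)| ≤ velVariance (f x) := by
    rw [h.velVariance_eq hx]
    refine _root_.abs_velAvg_le (h.integrable_sq_sub hx _) fun v hv h0 => ?_
    rw [abs_mul, abs_of_nonneg (sq_nonneg (f x v - velAvg (f x)))]
    exact mul_le_of_le_one_left (sq_nonneg _) (abs_le.2 hv)
  have h2 := abs_add_le (velAvg (fun v => v * (f x v - velAvg (f x)) ^ 2))
    (2 * velAvg (f x) * velAvg (fun v => v * f x v))
  have h3 : velAvg (fun v => v * (f x v - velAvg (f x)) ^ 2)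
    + 2 * velAvg (f x) * velAvg (fun v => v * f x v) = velAvg (fun v => v * f x v ^ 2) := by
    rw [e]; ring
  rw [h3, abs_mul, abs_mul, abs_two] at h2
  have h4 : 2 * |velAvg (f x)| * |velAvg (fun v => v * f x v)|
      ≤ 2 * Λ * |velAvg (fun v => v * f x v)| := by
    have := h.abs_velAvg_le hx
    gcongr
  linarith

lemma antitoneOn_energyFlux (h : TransportSolution xl xr σs σa Λ Kn f) :
    AntitoneOn (fun z => velAvg (fun v => v * f z v ^ 2)) (Ioo xl xr) := by
  refine antitoneOn_of_deriv_nonpos (convex_Ioo xl xr)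
    (fun z hz => (h.hasDerivAt_energyFlux hz).continuousAt.continuousWithinAt) ?_ ?_
  · rw [interior_Ioo]
    exact fun z hz => (h.hasDerivAt_energyFlux hz).differentiableAt.differentiableWithinAt
  · rw [interior_Ioo]
    intro z hz
    have hz' := Ioo_subset_Icc_self hz
    have h1 := h.velVariance_nonneg hz'
    have h2 := h.velAvg_sq_nonneg hz'
    have h3 := h.abs_nonneg z hz'
    have h4 := h.scat_pos hz'
    have h5 := h.Kn_pos
    rw [(h.hasDerivAt_energyFlux hz).deriv, neg_nonpos]
    positivity

/-- Mean value theorem for the energy flux: its decrease pays for the variance at rate `2 σs / Kn`,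
the absorption term having the favourable sign. -/
lemma exists_velVariance_le (h : TransportSolution xl xr σs σa Λ Kn f) {x z : ℝ}
    (hx : x ∈ Ioo xl xr) (hz : z ∈ Ioo xl xr) (hxz : x < z) :
    ∃ ξ ∈ Ioo x z, velVariance (f ξ) ≤ Λ * Kn / 2 *
      ((velAvg (fun v => v * f x v ^ 2) - velAvg (fun v => v * f z v ^ 2)) / (z - x)) := by
  have hK := h.Kn_pos
  have hΛ := h.pos
  have hsub : Icc x z ⊆ Ioo xl xr := fun w hw => ⟨by linarith [hw.1, hx.1], by linarith [hw.2, hz.2]⟩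
  obtain ⟨ξ, hξ, he⟩ := exists_hasDerivAt_eq_slope (fun z => velAvg (fun v => v * f z v ^ 2)) _ hxz
    (fun w hw => (h.hasDerivAt_energyFlux (hsub hw)).continuousAt.continuousWithinAt)
    (fun w hw => h.hasDerivAt_energyFlux (hsub (Ioo_subset_Icc_self hw)))
  have hξ' := Ioo_subset_Icc_self (hsub (Ioo_subset_Icc_self hξ))
  refine ⟨ξ, hξ, ?_⟩
  have h1 := h.velVariance_nonneg hξ'
  have h2 := h.velAvg_sq_nonneg hξ'
  have h3 := h.abs_nonneg ξ hξ'
  have h4 := h.scat_lower ξ hξ'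
  have h5 : 0 ≤ 2 * Kn * σa ξ * velAvg (fun v => f ξ v ^ 2) := by positivity
  have h6 : (velAvg (fun v => v * f x v ^ 2) - velAvg (fun v => v * f z v ^ 2)) / (z - x)
      = 2 * σs ξ / Kn * velVariance (f ξ) + 2 * Kn * σa ξ * velAvg (fun v => f ξ v ^ 2) := by
    rw [← neg_sub, neg_div, ← he, neg_neg]
  rw [h6]
  have h7 : 2 * Λ⁻¹ / Kn * velVariance (f ξ) ≤ 2 * σs ξ / Kn * velVariance (f ξ) := by gcongr
  calc velVariance (f ξ) = Λ * Kn / 2 * (2 * Λ⁻¹ / Kn * velVariance (f ξ)) := by field_simp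
    _ ≤ _ := by gcongr; linarith

/-- In the interior the energy flux is of the order of the Knudsen number. -/
lemma abs_energyFlux_le_Kn (h : TransportSolution xl xr σs σa Λ Kn f) {δ x : ℝ} (hδ : 0 < δ)
    (hxl : δ ≤ x - xl) (hxr : δ ≤ xr - x) :
    |velAvg (fun v => v * f x v ^ 2)| ≤ energyFluxConst Λ δ * Kn := by
  have hK := h.Kn_pos
  have hΛ := h.pos
  have hx : x ∈ Ioo xl xr := ⟨by linarith, by linarith⟩
  -- Each half window contains a point where the variance, hence the energy flux, is `O(Kn)`. As the
  -- energy flux decreases in `x`, the right point gives the lower bound at `x` and the left point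
  -- the upper one.
  have key : ∀ y z, y ∈ Ioo xl xr → z ∈ Ioo xl xr → z - y = δ / 2 → x - δ / 2 ≤ y →
      z ≤ x + δ / 2 → ∃ ξ ∈ Ioo y z,
      |velAvg (fun v => v * f ξ v ^ 2)| ≤ energyFluxConst Λ δ * Kn := by
    intro y z hy hz hyz hxy hzx
    obtain ⟨ξ, hξ, hle⟩ := h.exists_velVariance_le hy hz (by linarith)
    refine ⟨ξ, hξ, ?_⟩
    have hξ' : ξ ∈ Icc xl xr := ⟨by linarith [hξ.1, hy.1], by linarith [hξ.2, hz.2]⟩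
    have h1 := h.abs_energyFlux_le_flux hξ'
    have h2 := h.abs_flux_le (half_pos hδ) (by linarith [hξ.1] : δ / 2 ≤ ξ - xl)
      (by linarith [hξ.2])
    have h3 : (velAvg (fun v => v * f y v ^ 2) - velAvg (fun v => v * f z v ^ 2)) / (z - y)
        ≤ 4 * Λ ^ 2 / δ := by
      have a1 := abs_le.1 (h.abs_energyFlux_le (Ioo_subset_Icc_self hy))
      have a2 := abs_le.1 (h.abs_energyFlux_le (Ioo_subset_Icc_self hz))
      rw [hyz, div_le_div_iff₀ (by positivity) hδ]
      nlinarith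
    have h4 : velVariance (f ξ) ≤ Λ * Kn / 2 * (4 * Λ ^ 2 / δ) :=
      hle.trans (mul_le_mul_of_nonneg_left h3 (by positivity))
    have h5 : energyFluxConst Λ δ * Kn
        = 2 * Λ * (fluxConst Λ (δ / 2) * Kn) + Λ * Kn / 2 * (4 * Λ ^ 2 / δ) := by
      unfold energyFluxConst; ring
    rw [h5]
    have h6 : 2 * Λ * |velAvg (fun v => v * f ξ v)| ≤ 2 * Λ * (fluxConst Λ (δ / 2) * Kn) := by
      gcongr
    linarith
  have hanti := h.antitoneOn_energyFlux
  rw [abs_le]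
  constructor
  · obtain ⟨ξ, hξ, hle⟩ := key x (x + δ / 2) hx ⟨by linarith, by linarith⟩ (by ring) (by linarith)
      le_rfl
    have := hanti hx ⟨by linarith [hξ.1], by linarith [hξ.2]⟩ hξ.1.le
    exact (abs_le.1 hle).1.trans this
  · obtain ⟨ξ, hξ, hle⟩ := key (x - δ / 2) x ⟨by linarith, by linarith⟩ hx (by ring) le_rfl
      (by linarith)
    have := hanti ⟨by linarith [hξ.1], by linarith [hξ.2]⟩ hx hξ.2.le
    exact this.trans (abs_le.1 hle).2

/-- Interior bound for the velocity variance, with a free parameter `η`. -/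
lemma velVariance_le (h : TransportSolution xl xr σs σa Λ Kn f) {δ x η : ℝ} (hδ : 0 < δ)
    (hxl : δ ≤ x - xl) (hxr : δ ≤ xr - x) (hη : 0 < η) (hηK : η * Kn ≤ δ / 2) :
    velVariance (f x) ≤ Λ * energyFluxConst Λ (δ / 2) * Kn / η
      + 12 * Λ ^ 4 * velAvg velWeight * √η := by
  have hK := h.Kn_pos
  have hΛ := h.pos
  have hW := velAvg_velWeight_nonneg
  have hηK0 : 0 < η * Kn := by positivity
  have hx : x ∈ Ioo xl xr := ⟨by linarith, by linarith⟩
  -- On a window of length `η Kn` the `O(Kn)` energy flux gives variance `O(Kn / η)` at some `ξ`;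
  -- passing from `ξ` to `x` costs a multiple of `√η`.
  obtain ⟨ξ, hξ, hle⟩ := h.exists_velVariance_le hx
    (⟨by linarith, by linarith⟩ : x + η * Kn ∈ Ioo xl xr) (by linarith)
  have hξ' : ξ ∈ Icc xl xr := ⟨by linarith [hξ.1], by linarith [hξ.2]⟩
  have h1 := abs_le.1 (h.abs_energyFlux_le_Kn (half_pos hδ) (by linarith : δ / 2 ≤ x - xl)
    (by linarith))
  have h2 := abs_le.1 (h.abs_energyFlux_le_Kn (half_pos hδ)
    (by linarith : δ / 2 ≤ x + η * Kn - xl) (by linarith))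
  have h3 : velVariance (f ξ) ≤ Λ * energyFluxConst Λ (δ / 2) * Kn / η := by
    refine hle.trans ?_
    rw [add_sub_cancel_left]
    calc _ ≤ Λ * Kn / 2 * (2 * (energyFluxConst Λ (δ / 2) * Kn) / (η * Kn)) := by
          gcongr; linarith
      _ = _ := by field_simp
  have h4 := (abs_le.1 (h.abs_velVariance_sub_le (Ioo_subset_Icc_self hx) hξ')).2
  have h5 : √(|x - ξ| / Kn) ≤ √η := by
    refine Real.sqrt_le_sqrt ?_
    rw [div_le_iff₀ hK, abs_sub_comm, abs_of_pos (by linarith [hξ.1])]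
    linarith [hξ.2]
  have h6 : 12 * Λ ^ 4 * velAvg velWeight * √(|x - ξ| / Kn)
      ≤ 12 * Λ ^ 4 * velAvg velWeight * √η := by gcongr
  linarith

end TransportSolution

/-- In the interior the velocity variance vanishes uniformly in the diffusive limit. -/
lemma exists_velVariance_le (Λ : ℝ) {δ ε : ℝ} (hδ : 0 < δ) (hε : 0 < ε) :
    ∃ κ > 0, ∀ (xl xr : ℝ) (σs σa : ℝ → ℝ) (Kn : ℝ) (f : ℝ → ℝ → ℝ), Kn < κ →
      TransportSolution xl xr σs σa Λ Kn f → ∀ x, δ ≤ x - xl → δ ≤ xr - x →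
        velVariance (f x) ≤ ε := by
  rcases le_or_gt Λ 0 with hΛ | hΛ
  · exact ⟨1, one_pos, fun _ _ _ _ _ _ _ h => absurd h.pos (not_lt.2 hΛ)⟩
  have hW := velAvg_velWeight_nonneg
  have hE := energyFluxConst_nonneg hΛ.le (half_pos hδ).le
  set A := 12 * Λ ^ 4 * velAvg velWeight with hA
  have hA0 : 0 ≤ A := by positivity
  set B := Λ * energyFluxConst Λ (δ / 2) with hB
  have hB0 : 0 ≤ B := by positivity
  -- `η` is fixed first to make the Hölder cost at most `ε / 2`; only then is `Kn` restricted.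
  -- Adding `1` to `A` and `B` keeps the denominators positive.
  set η := (ε / (2 * (A + 1))) ^ 2 with hη
  have hη0 : 0 < η := by positivity
  refine ⟨min (δ / (2 * η)) (ε * η / (2 * (B + 1))), by positivity, ?_⟩
  intro xl xr σs σa Kn f hKn h x hxl hxr
  have hK := h.Kn_pos
  have hK1 := (hKn.trans_le (min_le_left _ _)).le
  have hK2 := (hKn.trans_le (min_le_right _ _)).le
  rw [le_div_iff₀ (by positivity)] at hK1 hK2
  have h1 := h.velVariance_le hδ hxl hxr hη0 (by linarith)
  have h2 : √η = ε / (2 * (A + 1)) := Real.sqrt_sq (by positivity)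
  have h3 : A * √η ≤ ε / 2 := by
    rw [h2, mul_div_assoc', div_le_div_iff₀ (by positivity) two_pos]
    nlinarith
  have h4 : B * Kn / η ≤ ε / 2 := by
    rw [div_le_div_iff₀ hη0 two_pos]
    nlinarith
  linarith

/-! ### The scaled density derivative and the derivative of the kernel. -/

namespace TransportSolution

variable {xl xr : ℝ} {σs σa : ℝ → ℝ} {Λ Kn : ℝ} {f : ℝ → ℝ → ℝ}

/-- Only absorption, of relative size `Kn ^ 2`, separates the density from the equilibrium. -/
lemma abs_velAvg_sub_localEquilibrium_le (h : TransportSolution xl xr σs σa Λ Kn f) {x : ℝ}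
    (hx : x ∈ Icc xl xr) :
    |velAvg (f x) - localEquilibrium σs σa Kn f x| ≤ Kn ^ 2 * Λ ^ 3 := by
  have hK := h.Kn_pos
  have hΛ := h.pos
  have hs := h.total_pos hx
  have e : velAvg (f x) - localEquilibrium σs σa Kn f x
      = Kn ^ 2 * σa x * velAvg (f x) / (σs x + Kn ^ 2 * σa x) := by
    rw [localEquilibrium, eq_div_iff hs.ne', sub_mul, div_mul_cancel₀ _ hs.ne']
    ring
  rw [e, abs_div, abs_mul, abs_mul, abs_of_pos hs, abs_of_pos (by positivity : 0 < Kn ^ 2),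
    abs_of_nonneg (h.abs_nonneg x hx), div_le_iff₀ hs]
  calc Kn ^ 2 * σa x * |velAvg (f x)| ≤ Kn ^ 2 * Λ * Λ := by
        gcongr
        exacts [h.abs_upper x hx, h.abs_velAvg_le hx]
    _ = Kn ^ 2 * Λ ^ 3 * Λ⁻¹ := by field_simp
    _ ≤ _ := by gcongr; exact h.total_lower hx

/-- Interior bound for the scaled derivative of the density, with a free velocity cutoff `t`. -/
lemma abs_Kn_mul_velAvg_transportDeriv_le (h : TransportSolution xl xr σs σa Λ Kn f) {δ x t : ℝ}
    (hδ : 0 < δ) (hxl : δ ≤ x - xl) (hxr : δ ≤ xr - x) (ht : 0 < t) :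
    |Kn * velAvg (transportDeriv σs σa Kn f x)| ≤ 2 * Λ ^ 3 *
      (t + (velVariance (f x) + (Kn ^ 2 * Λ ^ 3) ^ 2) / t ^ 3
        + equilibriumConst Λ δ * t ^ (1 / 4 : ℝ) * velAvg velWeight) := by
  have hK := h.Kn_pos
  have hΛ := h.pos
  have hC := h.equilibriumConst_nonneg hδ
  have hx : x ∈ Icc xl xr := ⟨by linarith, by linarith⟩
  set q := localEquilibrium σs σa Kn f x with hq
  have e1 : Kn * velAvg (transportDeriv σs σa Kn f x)
      = (σs x + Kn ^ 2 * σa x) * velAvg (fun v => (q - f x v) / v) := by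
    rw [← velAvg_const_mul, ← velAvg_const_mul]
    refine velAvg_congr fun v _ _ => ?_
    rw [h.transportDeriv_eq hx, ← mul_assoc, mul_div_cancel₀ _ hK.ne']
  have hi : VelIntegrable fun v => 1 / t ^ 3 * (f x v - q) ^ 2 :=
    (h.integrable_sq_sub hx q).const_mul _
  have hw : VelIntegrable fun v => equilibriumConst Λ δ * t ^ (1 / 4 : ℝ) * velWeight v :=
    velIntegrable_velWeight.const_mul _
  have e2 : |velAvg (fun v => (q - f x v) / v)|
      ≤ velAvg (fun v => (t + 1 / t ^ 3 * (f x v - q) ^ 2)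
        + equilibriumConst Λ δ * t ^ (1 / 4 : ℝ) * velWeight v) := by
    refine _root_.abs_velAvg_le (((velIntegrable_const t).add hi).add hw) fun v hv h0 => ?_
    have hv' := abs_pos.2 h0
    have p1 : 0 ≤ 1 / t ^ 3 * (f x v - q) ^ 2 := by positivity
    have p2 : 0 ≤ equilibriumConst Λ δ * t ^ (1 / 4 : ℝ) * velWeight v := by
      have := velWeight_nonneg v
      positivity
    rw [abs_div]
    -- Slow velocities use the `√|v|` estimate, with gain `t ^ (1/4)`. Fast ones use `e / t ≤ t + e
    -- ^ 2 / t ^ 3`, whose average involves only the variance.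
    rcases le_or_gt |v| t with hvt | hvt
    · have a1 : |q - f x v| / |v| ≤ equilibriumConst Λ δ * t ^ (1 / 4 : ℝ) * velWeight v := by
        calc |q - f x v| / |v| ≤ equilibriumConst Λ δ * √|v| / |v| := by
              gcongr; exact h.abs_sub_localEquilibrium_le hδ hxl hxr hv h0
          _ = equilibriumConst Λ δ * (√|v|)⁻¹ := by rw [mul_div_assoc, Real.sqrt_div_self]
          _ ≤ equilibriumConst Λ δ * (t ^ (1 / 4 : ℝ) * velWeight v) := by
              gcongr; exact inv_sqrt_le_mul_velWeight h0 hvt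
          _ = _ := by ring
      linarith
    · have a1 : |q - f x v| / |v| ≤ |q - f x v| / t := by gcongr
      have a2 : |q - f x v| / t ≤ t + 1 / t ^ 3 * (f x v - q) ^ 2 := by
        rw [← sq_abs (f x v - q), abs_sub_comm (f x v) q]
        set e := |q - f x v|
        rw [← sub_nonneg]
        have : t + 1 / t ^ 3 * e ^ 2 - e / t = ((e - t ^ 2 / 2) ^ 2 + 3 / 4 * t ^ 4) / t ^ 3 := by
          field_simp; ring
        rw [this]; positivity
      linarith
  have e3 : velAvg (fun v => (t + 1 / t ^ 3 * (f x v - q) ^ 2)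
        + equilibriumConst Λ δ * t ^ (1 / 4 : ℝ) * velWeight v)
      = t + 1 / t ^ 3 * (velVariance (f x) + (velAvg (f x) - q) ^ 2)
        + equilibriumConst Λ δ * t ^ (1 / 4 : ℝ) * velAvg velWeight := by
    rw [velAvg_add ((velIntegrable_const t).add hi) hw, velAvg_add (velIntegrable_const t) hi,
      velAvg_const, velAvg_const_mul, velAvg_const_mul, h.velAvg_sq_sub hx]
  have e4 : (velAvg (f x) - q) ^ 2 ≤ (Kn ^ 2 * Λ ^ 3) ^ 2 := by
    rw [← sq_abs]
    have := h.abs_velAvg_sub_localEquilibrium_le hx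
    gcongr
  rw [e1, abs_mul, abs_of_pos (h.total_pos hx)]
  refine mul_le_mul (h.total_upper hx) (e2.trans ?_) (_root_.abs_nonneg _) (by positivity)
  have e5 : 1 / t ^ 3 * (velVariance (f x) + (velAvg (f x) - q) ^ 2)
      ≤ (velVariance (f x) + (Kn ^ 2 * Λ ^ 3) ^ 2) / t ^ 3 := by
    rw [div_mul_eq_mul_div, one_mul]; gcongr
  rw [e3]
  linarith

/-- A transport solution for the velocity-reversed adjoint gives the derivative of `gammaKn`. -/
lemma hasDerivAt_gammaKn {g : ℝ → ℝ → ℝ} (h : TransportSolution xl xr σs σa Λ Kn f)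
    (hg : TransportSolution xl xr σs σa Λ Kn fun x v => g x (-v)) {x : ℝ} (hx : x ∈ Ioo xl xr)
    (ha : 0 < σa x) :
    HasDerivAt (fun z => velAvg (f z) * velAvg (g z))
      (velAvg (transportDeriv σs σa Kn f x) * velAvg (g x)
        + velAvg (f x) * velAvg (transportDeriv σs σa Kn (fun x v => g x (-v)) x)) x ∧
    HasDerivAt (gammaKn Kn f g) (Kn / (Kn ^ 2 + σs x / σa x) *
      (velAvg (transportDeriv σs σa Kn f x) * velAvg (g x)
        + velAvg (f x) * velAvg (transportDeriv σs σa Kn (fun x v => g x (-v)) x))) x := by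
  have hK := h.Kn_pos
  have hxx := Ioo_subset_Icc_self hx
  have d1 := h.hasDerivAt_velAvg hx
  have d2 := hg.hasDerivAt_velAvg hx
  have d3 := h.hasDerivAt_velAvg_mul_reversed hg hx
  simp only [velAvg_comp_neg (g _), neg_neg] at d2 d3
  have d4 := d1.mul d2
  refine ⟨d4, ?_⟩
  have heq : gammaKn Kn f g =ᶠ[𝓝 x]
      fun z => 1 / Kn * (velAvg (f z) * velAvg (g z) - velAvg (fun v => f z v * g z v)) := by
    filter_upwards [Ioo_mem_nhds hx.1 hx.2] with z hz
    have hz' := Ioo_subset_Icc_self hz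
    have hmg : VelMeasurable (g z) := by
      simpa using VelMeasurable.comp_neg (hg.phase.measurable z hz')
    have hbg : ∀ v ∈ Icc (-1 : ℝ) 1, v ≠ 0 → |g z v| ≤ Λ := fun v hv h0 => by
      simpa using hg.bound z hz' (-v) (neg_mem_velIcc hv) (neg_ne_zero.2 h0)
    have hig : VelIntegrable (g z) := hmg.integrable_of_bound hbg
    have hifg : VelIntegrable fun v => f z v * g z v :=
      VelMeasurable.integrable_of_bound ((h.phase.measurable z hz').mul hmg) (C := Λ * Λ)
        fun v hv h0 => by
          rw [abs_mul]
          exact mul_le_mul (h.bound z hz' v hv h0) (hbg v hv h0) (_root_.abs_nonneg _) h.pos.le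
    rw [gammaKn, ← velAvg_const_mul (velAvg (f z)) (g z), ← velAvg_sub (hig.const_mul _) hifg]
    congr 1
    exact velAvg_congr fun v _ _ => by rw [collision]; ring
  refine (((d4.sub d3).const_mul (1 / Kn)).congr_of_eventuallyEq heq).congr_deriv ?_
  have hs := h.total_pos hxx
  have h1 : Kn ^ 2 + σs x / σa x = (σs x + Kn ^ 2 * σa x) / σa x := by field_simp; ring
  rw [h1]
  field_simp
  ring

end TransportSolution

/-- In the interior the scaled derivative of the density vanishes uniformly in the diffusive
limit. -/
lemma exists_abs_Kn_mul_velAvg_transportDeriv_le (Λ : ℝ) {δ ε : ℝ} (hδ : 0 < δ) (hε : 0 < ε) :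
    ∃ κ > 0, ∀ (xl xr : ℝ) (σs σa : ℝ → ℝ) (Kn : ℝ) (f : ℝ → ℝ → ℝ), Kn < κ →
      TransportSolution xl xr σs σa Λ Kn f → ∀ x, δ ≤ x - xl → δ ≤ xr - x →
        |Kn * velAvg (transportDeriv σs σa Kn f x)| ≤ ε := by
  rcases le_or_gt Λ 0 with hΛ | hΛ
  · exact ⟨1, one_pos, fun _ _ _ _ _ _ _ h => absurd h.pos (not_lt.2 hΛ)⟩
  have hlim : Tendsto (fun t : ℝ => 2 * Λ ^ 3 *
      (t + equilibriumConst Λ δ * t ^ (1 / 4 : ℝ) * velAvg velWeight)) (𝓝[>] 0) (𝓝 0) := by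
    have hc : Continuous (fun t : ℝ => 2 * Λ ^ 3 *
        (t + equilibriumConst Λ δ * t ^ (1 / 4 : ℝ) * velAvg velWeight)) := by
      have : Continuous fun t : ℝ => t ^ (1 / 4 : ℝ) := Real.continuous_rpow_const (by norm_num)
      fun_prop
    have := hc.tendsto 0
    rw [Real.zero_rpow (by norm_num)] at this
    simp only [mul_zero, zero_mul, add_zero] at this
    exact this.mono_left nhdsWithin_le_nhds
  obtain ⟨t, hte, ht⟩ := ((hlim.eventually_lt_const (half_pos hε)).and
    self_mem_nhdsWithin).exists
  have ht0 : 0 < t := ht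
  -- With the cutoff `t` already fixed, the variance and the equilibrium error are each at most
  -- `ε'`; the factor `2 * Λ ^ 3 / t ^ 3` turns `2 ε'` into `ε / 2`.
  set ε' := ε * t ^ 3 / (8 * Λ ^ 3) with hε'
  have hε'0 : 0 < ε' := by positivity
  obtain ⟨κ, hκ, hD⟩ := exists_velVariance_le Λ hδ hε'0
  refine ⟨min κ (ε' / Λ ^ 9), by positivity, ?_⟩
  intro xl xr σs σa Kn f hKn h x hxl hxr
  have hK := h.Kn_pos
  have h1 := hD xl xr σs σa Kn f (hKn.trans_le (min_le_left _ _)) h x hxl hxr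
  have h2 := (hKn.trans_le (min_le_right _ _)).le
  rw [le_div_iff₀ (by positivity)] at h2
  have h3 : (Kn ^ 2 * Λ ^ 3) ^ 2 ≤ ε' := by
    refine le_trans ?_ h2
    calc (Kn ^ 2 * Λ ^ 3) ^ 2 = Kn * Kn ^ 3 * Λ ^ 6 := by ring
      _ ≤ Kn * Λ ^ 3 * Λ ^ 6 := by have := h.Kn_le; gcongr
      _ = Kn * Λ ^ 9 := by ring
  refine (h.abs_Kn_mul_velAvg_transportDeriv_le hδ hxl hxr ht0).trans ?_
  have h4 : 2 * Λ ^ 3 * ((velVariance (f x) + (Kn ^ 2 * Λ ^ 3) ^ 2) / t ^ 3) ≤ ε / 2 := by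
    calc _ ≤ 2 * Λ ^ 3 * ((ε' + ε') / t ^ 3) := by gcongr
      _ = ε / 2 := by rw [hε']; field_simp; ring
  linarith

/-! ### Bounds independent of the Knudsen number. -/

/-- One step of the maximum principle. -/
lemma abs_le_max_of_inflow {xl xr : ℝ} {σs σa : ℝ → ℝ} {Kn M N θ : ℝ} {f : ℝ → ℝ → ℝ}
    (hK : 0 < Kn) (hσs : ∀ x ∈ Icc xl xr, 0 < σs x)
    (hσa : ∀ x ∈ Icc xl xr, 0 < σa x) (hN : 0 ≤ N)
    (hθ : ∀ x ∈ Icc xl xr, 1 / Kn * σs x ≤ θ * (1 / Kn * σs x + Kn * σa x))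
    (hf : IsPhaseFunction xl xr f)
    (heq : ∀ v ∈ Icc (-1 : ℝ) 1, v ≠ 0 → ∀ x ∈ Ioo xl xr, v * deriv (fun z => f z v) x
      = (1 / Kn) * σs x * collision (f x) v - Kn * σa x * f x v)
    (hin : ∀ p ∈ inflowBdry xl xr, |f p.1 p.2| ≤ M)
    (hb : ∀ x ∈ Icc xl xr, ∀ v ∈ Icc (-1 : ℝ) 1, v ≠ 0 → |f x v| ≤ N) :
    ∀ x ∈ Icc xl xr, ∀ v ∈ Icc (-1 : ℝ) 1, v ≠ 0 → |f x v| ≤ max M (θ * N) := by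
  intro x hxx v hv h0
  set A := max M (θ * N)
  have htot : ∀ z ∈ Ioo xl xr, 0 < 1 / Kn * σs z + Kn * σa z := fun z hz => by
    have := hσs z (Ioo_subset_Icc_self hz)
    have := hσa z (Ioo_subset_Icc_self hz)
    positivity
  have main : ∀ ε : ℝ, |ε| = 1 → 0 ≤ A - ε * f x v := by
    intro ε hε
    have hεle : ∀ t : ℝ, ε * t ≤ |t| := fun t => by
      have := le_abs_self (ε * t)
      rwa [abs_mul, hε, one_mul] at this
    have hc : ContinuousOn (fun z => A - ε * f z v) (Icc xl xr) :=
      continuousOn_const.sub ((hf.continuousOn v hv h0).const_smul ε)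
    have hd : ∀ z ∈ Ioo xl xr, DifferentiableAt ℝ (fun z => A - ε * f z v) z := fun z hz =>
      ((hf.differentiableAt v hv h0 z hz).const_mul ε).const_sub A
    have hineq : ∀ z ∈ Ioo xl xr, 0 ≤ v * deriv (fun z => A - ε * f z v) z
        + (1 / Kn * σs z + Kn * σa z) * (A - ε * f z v) := by
      intro z hz
      have hz' := Ioo_subset_Icc_self hz
      have e1 : deriv (fun z => A - ε * f z v) z = -(ε * deriv (fun z => f z v) z) :=
        (((hf.differentiableAt v hv h0 z hz).hasDerivAt.const_mul ε).const_sub A).deriv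
      have e2 := heq v hv h0 z hz
      -- The total cross section cancels `f x v` itself; only the density remains, weighted by
      -- scattering, which is at most `θ` times the total.
      have e3 : v * deriv (fun z => A - ε * f z v) z
          + (1 / Kn * σs z + Kn * σa z) * (A - ε * f z v)
          = (1 / Kn * σs z + Kn * σa z) * A - 1 / Kn * σs z * (ε * velAvg (f z)) := by
        rw [e1]
        rw [collision] at e2
        linear_combination -ε * e2
      rw [e3, sub_nonneg]
      have hk : 0 < 1 / Kn * σs z := by have := hσs z hz'; positivity
      calc 1 / Kn * σs z * (ε * velAvg (f z)) ≤ 1 / Kn * σs z * N := by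
            gcongr
            exact (hεle _).trans (abs_velAvg_le_const (hb z hz'))
        _ ≤ θ * (1 / Kn * σs z + Kn * σa z) * N := mul_le_mul_of_nonneg_right (hθ z hz') hN
        _ = (1 / Kn * σs z + Kn * σa z) * (θ * N) := by ring
        _ ≤ _ := by have := htot z hz; gcongr; exact le_max_right _ _
    have hbd : ∀ p ∈ inflowBdry xl xr, 0 ≤ A - ε * f p.1 p.2 := fun p hp =>
      sub_nonneg.2 ((hεle _).trans ((hin p hp).trans (le_max_left _ _)))
    rcases lt_or_gt_of_ne h0 with hneg | hpos
    · exact nonneg_of_transport_neg hneg hc hd htot hineq (hbd (xr, v) (Or.inr ⟨rfl, hv.1, hneg⟩)) hxx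
    · exact nonneg_of_transport_pos hpos hc hd htot hineq (hbd (xl, v) (Or.inl ⟨rfl, hpos, hv.2⟩)) hxx
  have h1 := main 1 (by simp)
  have h2 := main (-1) (by simp)
  rw [abs_le]
  constructor <;> linarith

/-- The maximum principle. -/
lemma abs_le_of_inflow {xl xr : ℝ} {σs σa : ℝ → ℝ} {Kn M : ℝ} {f : ℝ → ℝ → ℝ}
    (hx : xl < xr) (hK : 0 < Kn) (hcs : ContinuousOn σs (Icc xl xr))
    (hca : ContinuousOn σa (Icc xl xr)) (hσs : ∀ x ∈ Icc xl xr, 0 < σs x)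
    (hσa : ∀ x ∈ Icc xl xr, 0 < σa x) (hf : IsPhaseFunction xl xr f)
    (heq : ∀ v ∈ Icc (-1 : ℝ) 1, v ≠ 0 → ∀ x ∈ Ioo xl xr, v * deriv (fun z => f z v) x
      = (1 / Kn) * σs x * collision (f x) v - Kn * σa x * f x v)
    (hin : ∀ p ∈ inflowBdry xl xr, |f p.1 p.2| ≤ M) :
    ∀ x ∈ Icc xl xr, ∀ v ∈ Icc (-1 : ℝ) 1, v ≠ 0 → |f x v| ≤ M := by
  have htot : ∀ z ∈ Icc xl xr, 0 < 1 / Kn * σs z + Kn * σa z := fun z hz => by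
    have := hσs z hz
    have := hσa z hz
    positivity
  -- The scattering ratio attains its maximum `θ`, and positive absorption there gives `θ < 1`.
  obtain ⟨y, hy, hmax⟩ := isCompact_Icc.exists_isMaxOn (nonempty_Icc.2 hx.le)
    ((hcs.const_smul (1 / Kn)).div ((hcs.const_smul (1 / Kn)).add (hca.const_smul Kn))
      fun z hz => (htot z hz).ne')
  set θ := 1 / Kn * σs y / (1 / Kn * σs y + Kn * σa y) with hθ
  have hθ0 : 0 ≤ θ := by
    have := hσs y hy
    have := htot y hy
    positivity
  have hθ1 : θ < 1 := by
    rw [hθ, div_lt_one (htot y hy)]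
    have := hσa y hy
    have : 0 < Kn * σa y := by positivity
    linarith
  have hθle : ∀ x ∈ Icc xl xr, 1 / Kn * σs x ≤ θ * (1 / Kn * σs x + Kn * σa x) := fun x hx =>
    (div_le_iff₀ (htot x hx)).1 (hmax hx)
  have hM : 0 ≤ M := (abs_nonneg _).trans (hin (xl, 1) (Or.inl ⟨rfl, one_pos, le_rfl⟩))
  obtain ⟨N, hN⟩ := hf.bounded
  have hN0 : 0 ≤ N := (abs_nonneg _).trans
    (hN xl (left_mem_Icc.2 hx.le) 1 (right_mem_Icc.2 (by norm_num)))
  -- Starting from any bound `N`, each step contracts the excess over the inflow bound by `θ`;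
  -- letting `n → ∞` removes `N`.
  have hiter : ∀ n : ℕ, ∀ x ∈ Icc xl xr, ∀ v ∈ Icc (-1 : ℝ) 1, v ≠ 0 →
      |f x v| ≤ max M (θ ^ n * N) := by
    intro n
    induction n with
    | zero => exact fun x hx v hv _ => le_max_of_le_right (by simpa using hN x hx v hv)
    | succ n ih =>
      intro x hxx v hv h0
      refine (abs_le_max_of_inflow hK hσs hσa (le_max_of_le_left hM) hθle hf heq hin ih
        x hxx v hv h0).trans (max_le (le_max_left _ _) ?_)
      rw [mul_max_of_nonneg _ _ hθ0, pow_succ', mul_assoc]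
      exact max_le_max (mul_le_of_le_one_left hM hθ1.le) le_rfl
  intro x hxx v hv h0
  have hlim : Tendsto (fun n : ℕ => max M (θ ^ n * N)) atTop (𝓝 (max M (0 * N))) :=
    tendsto_const_nhds.max ((tendsto_pow_atTop_nhds_zero_of_lt_one hθ0 hθ1).mul_const N)
  rw [zero_mul, max_eq_left hM] at hlim
  exact ge_of_tendsto' hlim fun n => hiter n x hxx v hv h0

/-! ### Velocity reversal and a common constant for the coefficients. -/

lemma IsPhaseFunction.reverse {xl xr : ℝ} {g : ℝ → ℝ → ℝ} (h : IsPhaseFunction xl xr g) :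
    IsPhaseFunction xl xr fun x v => g x (-v) where
  bounded := by
    obtain ⟨M, hM⟩ := h.bounded
    exact ⟨M, fun x hx v hv => hM x hx _ (neg_mem_velIcc hv)⟩
  measurable x hx := VelMeasurable.comp_neg (h.measurable x hx)
  continuousOn v hv h0 := h.continuousOn _ (neg_mem_velIcc hv) (neg_ne_zero.2 h0)
  differentiableAt v hv h0 := h.differentiableAt _ (neg_mem_velIcc hv) (neg_ne_zero.2 h0)

/-- Reversal flips the sign of the transport term, preserves `velAvg`, and exchanges the two
boundary sets. -/
lemma IsAdjointRTESolution.reverse {xl xr : ℝ} {σs σa : ℝ → ℝ} {Kn : ℝ} {ψ : ℝ → ℝ}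
    {g : ℝ → ℝ → ℝ} (h : IsAdjointRTESolution xl xr σs σa Kn ψ g) :
    IsRTESolution xl xr σs σa Kn (fun p => ψ p.1) fun x v => g x (-v) where
  phase := h.phase.reverse
  equation v hv h0 x hx := by
    have := h.equation (-v) (neg_mem_velIcc hv) (neg_ne_zero.2 h0) x hx
    rw [collision] at this
    rw [collision, velAvg_comp_neg (g x), ← this]
    ring
  inflow p hp := by
    refine h.outflow (p.1, -p.2) ?_
    rcases hp with ⟨h1, h2, h3⟩ | ⟨h1, h2, h3⟩
    · exact Or.inl ⟨h1, by simpa using h3, by simpa using h2⟩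
    · exact Or.inr ⟨h1, by simpa using h3, by simp only; linarith⟩

lemma ContDiffOn.exists_lipschitz_Icc {a b : ℝ} (hab : a < b) {σ : ℝ → ℝ}
    (h : ContDiffOn ℝ 1 σ (Icc a b)) :
    ∃ C : ℝ, ∀ x ∈ Icc a b, ∀ z ∈ Icc a b, |σ x - σ z| ≤ C * |x - z| := by
  have hc := h.continuousOn_derivWithin (uniqueDiffOn_Icc hab) le_rfl
  obtain ⟨C, hC⟩ := isCompact_Icc.exists_bound_of_continuousOn hc
  refine ⟨C, fun x hx z hz => ?_⟩
  exact (convex_Icc a b).norm_image_sub_le_of_norm_derivWithin_le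
    (h.differentiableOn one_ne_zero) hC hz hx

/-- All sufficiently large constants control given coefficients in the sense of
`TransportSolution`. -/
lemma exists_forall_transportSolution {xl xr : ℝ} (hx : xl < xr) {σs σa : ℝ → ℝ}
    (hσs : ContDiffOn ℝ 1 σs (Icc xl xr)) (hσa : ContDiffOn ℝ 1 σa (Icc xl xr))
    (hσs_pos : ∀ x ∈ Icc xl xr, 0 < σs x) (hσa_pos : ∀ x ∈ Icc xl xr, 0 < σa x) :
    ∃ Λ₀ : ℝ, 1 ≤ Λ₀ ∧ ∀ Λ, Λ₀ ≤ Λ → ∀ (Kn : ℝ) (φ : ℝ × ℝ → ℝ) (f : ℝ → ℝ → ℝ), 0 < Kn →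
      Kn ≤ Λ → IsRTESolution xl xr σs σa Kn φ f →
      (∀ x ∈ Icc xl xr, ∀ v ∈ Icc (-1 : ℝ) 1, v ≠ 0 → |f x v| ≤ Λ) →
      TransportSolution xl xr σs σa Λ Kn f := by
  obtain ⟨C₁, hC₁⟩ := hσs.exists_lipschitz_Icc hx
  obtain ⟨C₂, hC₂⟩ := hσa.exists_lipschitz_Icc hx
  obtain ⟨B₁, hB₁⟩ := isCompact_Icc.exists_bound_of_continuousOn hσs.continuousOn
  obtain ⟨B₂, hB₂⟩ := isCompact_Icc.exists_bound_of_continuousOn hσa.continuousOn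
  obtain ⟨B₃, hB₃⟩ := isCompact_Icc.exists_bound_of_continuousOn
    (hσs.continuousOn.inv₀ fun x hx => (hσs_pos x hx).ne')
  refine ⟨max 1 (max (xr - xl) (max C₁ (max C₂ (max B₁ (max B₂ B₃))))), le_max_left _ _, ?_⟩
  intro Λ hΛ Kn φ f hK hKΛ hf hb
  simp only [max_le_iff] at hΛ
  obtain ⟨h1, h2, h3, h4, h5, h6, h7⟩ := hΛ
  refine ⟨h1, h2, hK, hKΛ, fun x hx => ?_, fun x hx => ?_, fun x hx z hz => ?_,
    fun x hx => (hσa_pos x hx).le, fun x hx => ?_, fun x hx z hz => ?_, hf.phase, hf.equation, hb⟩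
  · exact inv_le_of_inv_le₀ (hσs_pos x hx) ((le_abs_self _).trans ((hB₃ x hx).trans h7))
  · exact (le_abs_self _).trans ((hB₁ x hx).trans h5)
  · exact (hC₁ x hx z hz).trans (by gcongr)
  · exact (le_abs_self _).trans ((hB₂ x hx).trans h6)
  · exact (hC₂ x hx z hz).trans (by gcongr)

lemma abs_bdryDelta_le (y x : ℝ) : |bdryDelta y x| ≤ 1 := by
  unfold bdryDelta indicator
  split_ifs <;> simp

end

/-! ### Proof of the identity and of the limit. -/

theorem mainTheorem8 (xl xr : ℝ) (hx : xl < xr) (σs0 σa : ℝ → ℝ)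
    (hσs0 : ContDiffOn ℝ 1 σs0 (Icc xl xr)) (hσa : ContDiffOn ℝ 1 σa (Icc xl xr))
    (hσs0_pos : ∀ x ∈ Icc xl xr, 0 < σs0 x) (hσa_pos : ∀ x ∈ Icc xl xr, 0 < σa x)
    (φ : ℝ × ℝ → ℝ) (y : ℝ) (hy : y = xl ∨ y = xr) :
    (∀ Kn : ℝ, 0 < Kn → ∀ f₀ g : ℝ → ℝ → ℝ,
      IsRTESolution xl xr σs0 σa Kn φ f₀ →
      IsAdjointRTESolution xl xr σs0 σa Kn (bdryDelta y) g →
      ∀ x ∈ Ioo xl xr,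
        DifferentiableAt ℝ (fun z => velAvg (f₀ z) * velAvg (g z)) x ∧
        DifferentiableAt ℝ (gammaKn Kn f₀ g) x ∧
        deriv (gammaKn Kn f₀ g) x
          = Kn / (Kn ^ 2 + σs0 x / σa x)
            * deriv (fun z => velAvg (f₀ z) * velAvg (g z)) x) ∧
    (∀ f₀ g : ℝ → ℝ → ℝ → ℝ,
      (∀ Kn : ℝ, 0 < Kn → IsRTESolution xl xr σs0 σa Kn φ (f₀ Kn)) →
      (∀ Kn : ℝ, 0 < Kn → IsAdjointRTESolution xl xr σs0 σa Kn (bdryDelta y) (g Kn)) →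
      TendstoLocallyUniformlyOn (fun Kn x => deriv (gammaKn Kn (f₀ Kn) (g Kn)) x)
        (fun _ => 0) (𝓝[>] (0 : ℝ)) (Ioo xl xr)) := by
  obtain ⟨Λ₀, hΛ₀, hT⟩ := exists_forall_transportSolution hx hσs0 hσa hσs0_pos hσa_pos
  constructor
  · intro Kn hK f g hf hg x hxx
    obtain ⟨M₁, hM₁⟩ := hf.phase.bounded
    obtain ⟨M₂, hM₂⟩ := hg.reverse.phase.bounded
    -- Here `Kn` is fixed, so the constant may depend on it and on the given solutions.
    set Λ := max Λ₀ (max Kn (max M₁ M₂)) with hΛ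
    have e1 : Λ₀ ≤ Λ := le_max_left _ _
    have e2 : Kn ≤ Λ := (le_max_left _ _).trans (le_max_right _ _)
    have e3 : M₁ ≤ Λ := (le_max_left _ _).trans ((le_max_right _ _).trans (le_max_right _ _))
    have e4 : M₂ ≤ Λ := (le_max_right _ _).trans ((le_max_right _ _).trans (le_max_right _ _))
    have tf := hT Λ e1 Kn _ f hK e2 hf fun x hx v hv _ => (hM₁ x hx v hv).trans e3
    have tg := hT Λ e1 Kn _ _ hK e2 hg.reverse fun x hx v hv _ => (hM₂ x hx v hv).trans e4
    obtain ⟨d1, d2⟩ := tf.hasDerivAt_gammaKn tg hxx (hσa_pos x (Ioo_subset_Icc_self hxx))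
    exact ⟨d1.differentiableAt, d2.differentiableAt, by rw [d1.deriv, d2.deriv]⟩
  · intro f g hf hg
    -- The solution at `Kn = 1` serves only to show that the inflow data are bounded; the maximum
    -- principle then bounds `f Kn` by the same `M` for every `Kn`.
    obtain ⟨M, hM⟩ := (hf 1 one_pos).phase.bounded
    have hφ : ∀ p ∈ inflowBdry xl xr, |φ p| ≤ M := by
      intro p hp
      rw [← (hf 1 one_pos).inflow p hp]
      rcases hp with ⟨h1, h2, h3⟩ | ⟨h1, h2, h3⟩
      · exact hM _ (by rw [h1]; exact left_mem_Icc.2 hx.le) _ ⟨by linarith, h3⟩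
      · exact hM _ (by rw [h1]; exact right_mem_Icc.2 hx.le) _ ⟨h2, by linarith⟩
    set Λ := max Λ₀ M with hΛ
    have e1 : Λ₀ ≤ Λ := le_max_left _ _
    have hΛ1 : 1 ≤ Λ := hΛ₀.trans e1
    have hΛ0 : 0 < Λ := one_pos.trans_le hΛ1
    have tf : ∀ Kn, 0 < Kn → Kn ≤ 1 → TransportSolution xl xr σs0 σa Λ Kn (f Kn) := by
      intro Kn hK hK1
      refine hT Λ e1 Kn _ _ hK (hK1.trans hΛ1) (hf Kn hK) fun x hxx v hv h0 => ?_
      exact (abs_le_of_inflow hx hK hσs0.continuousOn hσa.continuousOn hσs0_pos hσa_pos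
        (hf Kn hK).phase (hf Kn hK).equation
        (fun p hp => by rw [(hf Kn hK).inflow p hp]; exact hφ p hp) x hxx v hv h0).trans
        (le_max_right _ _)
    have tg : ∀ Kn, 0 < Kn → Kn ≤ 1 →
        TransportSolution xl xr σs0 σa Λ Kn fun x v => g Kn x (-v) := by
      intro Kn hK hK1
      have hr := (hg Kn hK).reverse
      refine hT Λ e1 Kn _ _ hK (hK1.trans hΛ1) hr fun x hxx v hv h0 => ?_
      exact (abs_le_of_inflow hx hK hσs0.continuousOn hσa.continuousOn hσs0_pos hσa_pos
        hr.phase hr.equation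
        (fun p hp => by rw [hr.inflow p hp]; exact abs_bdryDelta_le _ _) x hxx v hv h0).trans hΛ1
    rw [Metric.tendstoLocallyUniformlyOn_iff]
    intro ε hε x hxx
    set δ := min ((x - xl) / 2) ((xr - x) / 2) with hδ
    have hδ0 : 0 < δ := lt_min (by linarith [hxx.1]) (by linarith [hxx.2])
    have hδl : δ ≤ (x - xl) / 2 := min_le_left _ _
    have hδr : δ ≤ (xr - x) / 2 := min_le_right _ _
    -- The tolerance is chosen so that two products, each with a density at most `Λ`, and the
    -- prefactor at most `Λ ^ 2` give `ε / 2`.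
    obtain ⟨κ, hκ, hκε⟩ := exists_abs_Kn_mul_velAvg_transportDeriv_le Λ hδ0
      (by positivity : 0 < ε / (4 * Λ ^ 3))
    refine ⟨Ioo (x - δ) (x + δ), mem_nhdsWithin_of_mem_nhds
      (Ioo_mem_nhds (by linarith) (by linarith)), ?_⟩
    filter_upwards [Ioo_mem_nhdsGT (lt_min hκ one_pos)] with Kn hKn z hz
    have hK : 0 < Kn := hKn.1
    have hKκ : Kn < κ := hKn.2.trans_le (min_le_left _ _)
    have hK1 : Kn ≤ 1 := hKn.2.le.trans (min_le_right _ _)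
    have hzl : δ ≤ z - xl := by linarith [hz.1]
    have hzr : δ ≤ xr - z := by linarith [hz.2]
    have hz' : z ∈ Ioo xl xr := ⟨by linarith, by linarith⟩
    have hzz := Ioo_subset_Icc_self hz'
    have tf' := tf Kn hK hK1
    have tg' := tg Kn hK hK1
    have b1 := hκε _ _ _ _ _ _ hKκ tf' z hzl hzr
    have b2 := hκε _ _ _ _ _ _ hKκ tg' z hzl hzr
    have b3 := tf'.abs_velAvg_le hzz
    have b4 := tg'.abs_velAvg_le hzz
    rw [velAvg_comp_neg (g Kn z)] at b4
    rw [(tf'.hasDerivAt_gammaKn tg' hz' (hσa_pos z hzz)).2.deriv, dist_zero_left, Real.norm_eq_abs]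
    set ρ₁ := velAvg (f Kn z)
    set ρ₂ := velAvg (g Kn z)
    set D₁ := velAvg (transportDeriv σs0 σa Kn (f Kn) z)
    set D₂ := velAvg (transportDeriv σs0 σa Kn (fun x v => g Kn x (-v)) z)
    have hσs := hσs0_pos z hzz
    have hσ := hσa_pos z hzz
    have c1 : (Λ ^ 2)⁻¹ ≤ Kn ^ 2 + σs0 z / σa z := by
      have : (Λ ^ 2)⁻¹ ≤ σs0 z / σa z := by
        calc (Λ ^ 2)⁻¹ = Λ⁻¹ / Λ := by field_simp
          _ ≤ σs0 z / σa z := by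
            gcongr
            exacts [tf'.scat_lower z hzz, tf'.abs_upper z hzz]
      have := sq_nonneg Kn
      linarith
    have c2 : Kn / (Kn ^ 2 + σs0 z / σa z) * (D₁ * ρ₂ + ρ₁ * D₂)
        = (Kn ^ 2 + σs0 z / σa z)⁻¹ * (Kn * D₁ * ρ₂ + ρ₁ * (Kn * D₂)) := by
      rw [div_eq_inv_mul]; ring
    have c3 : (Kn ^ 2 + σs0 z / σa z)⁻¹ ≤ Λ ^ 2 := inv_le_of_inv_le₀ (by positivity) c1
    have c4 : |Kn * D₁ * ρ₂ + ρ₁ * (Kn * D₂)| ≤ ε / (4 * Λ ^ 3) * Λ + Λ * (ε / (4 * Λ ^ 3)) := by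
      refine (abs_add_le _ _).trans ?_
      rw [abs_mul (Kn * D₁), abs_mul ρ₁]
      gcongr
    rw [c2, abs_mul, abs_of_pos (by positivity)]
    calc _ ≤ Λ ^ 2 * (ε / (4 * Λ ^ 3) * Λ + Λ * (ε / (4 * Λ ^ 3))) := by gcongr
      _ = ε / 2 := by field_simp; ring
      _ < ε := half_lt_self hε
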